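/- Consider $-u''+q(x)u=\lambda u$ on $[0,1]$ with real potential $q\in L^2[0,1]$ (solutions: $u\in C^1[0,1]$ with $u'$ absolutely continuous, the equation holding almost everywhere). For angles $a,b\in\mathbb R$ let $(ab)$ denote the boundary conditions $u(0)\cos a+u'(0)\sin a=0$, $u(1)\cos b+u'(1)\sin b=0$. Fix $\alpha,\beta,\gamma\in\mathbb R$ with $\sin(\beta-\gamma)\neq 0$, and let $\lambda_{q,1,0}<\lambda_{q,1,1}<\dots$ and $\lambda_{q,2,0}<\lambda_{q,2,1}<\dots$ be the eigenvalues of $q$ for the boundary conditions $(\alpha\beta)$ and $(\alpha\gamma)$, respectively. Let $I\subseteq\{1,2\}\times\{0,1,2,\dots\}$, let $\omega_{i,n}>0$ for $(i,n)\in I$, let $Q\in L^2[0,1]$ be real, and assume that $I$ is finite or $\sum_{(i,n)\in I}n\,\omega_{i,n}<\infty$. Then $$G(q)=\sum_{(i,n)\in I}\omega_{i,n}(\lambda_{q,i,n}-\lambda_{Q,i,n})^2$$ converges for every real $q\in L^2[0,1]$; the directional derivative $\dot G[h](q)=\frac{d}{dt}G(q+th)\big|_{t=0}$ exists for every real $q\in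 L^2[0,1]$ and $h\in H^1[0,1]$; and for every real $q\in L^2[0,1]$ $$\dot G[h](q)=0\ \text{ for all } h\in H^1[0,1]\iff G(q)=0.$$ In particular, every such critical point of $G$ is a global minimum of $G$, and $G$ has no local minimum (with respect to the $L^2$ norm) at any $q$ with $G(q)>0$. -/

import Mathlib

open Set MeasureTheory
open scoped ContDiff

namespace SturmLiouville

noncomputable section

/-- The space of potentials `L²([0,1], ℝ)`. -/
abbrev L2 : Type := Lp ℝ 2 ((volume : Measure ℝ).restrict (Icc (0 : ℝ) 1))

/-- `h ∈ H¹[0,1]`: the function `h ∈ L²[0,1]` has a weak derivative `h' ∈ L²[0,1]`, tested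
against smooth functions with compact support in the open interval `(0,1)`. -/
def MemH1 (h : L2) : Prop :=
  ∃ h' : L2, ∀ φ : ℝ → ℝ, ContDiff ℝ ∞ φ → HasCompactSupport φ → tsupport φ ⊆ Ioo 0 1 →
    ∫ x in (0 : ℝ)..1, h x * deriv φ x = -∫ x in (0 : ℝ)..1, h' x * φ x

/-- `u` is a solution of `-u'' + q u = μ u` on `[0,1]` and `v = u'`: `u` is differentiable on
`[0,1]` (one-sidedly at the endpoints) with derivative `v`, and `v` is absolutely continuous with
`v' = (q - μ) u` almost everywhere, which is written as an integral equation. -/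
structure IsSolution (q : L2) (μ : ℝ) (u v : ℝ → ℝ) : Prop where
  hasDeriv : ∀ x ∈ Icc (0 : ℝ) 1, HasDerivWithinAt u (v x) (Icc 0 1) x
  integral_eq : ∀ x ∈ Icc (0 : ℝ) 1, v x = v 0 + ∫ s in (0 : ℝ)..x, (q s - μ) * u s

/-- `μ` is an eigenvalue of `-u'' + q u = μ u` under the separated boundary conditions
`u(0) cos a + u'(0) sin a = 0` and `u(1) cos b + u'(1) sin b = 0`: there is a solution satisfying
them that is not identically zero on `[0,1]`. -/
def IsEigenvalue (q : L2) (a b μ : ℝ) : Prop :=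
  ∃ u v : ℝ → ℝ, IsSolution q μ u v ∧
    u 0 * Real.cos a + v 0 * Real.sin a = 0 ∧
    u 1 * Real.cos b + v 1 * Real.sin b = 0 ∧
    ∃ x ∈ Icc (0 : ℝ) 1, u x ≠ 0

/-- The `n`-th eigenvalue in increasing order, `n = 0, 1, 2, …`: the eigenvalue below which
there are exactly `n` others. (There is exactly one, so the infimum is over a singleton.) -/
def eigenvalue (q : L2) (a b : ℝ) (n : ℕ) : ℝ :=
  sInf {μ : ℝ | IsEigenvalue q a b μ ∧ {ν : ℝ | IsEigenvalue q a b ν ∧ ν < μ}.encard = n}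

/-- `lam α β γ q (i, n)` is the `n`-th eigenvalue of `q` under the boundary conditions `(α β)`
for the first value of the index `i` and `(α γ)` for the second. -/
def lam (α β γ : ℝ) (q : L2) (k : Fin 2 × ℕ) : ℝ :=
  eigenvalue q α (if k.1 = 0 then β else γ) k.2

/-- The least squares functional
`G(q) = ∑_{(i,n) ∈ I} ω_{i,n} (λ_{q,i,n} - λ_{Q,i,n})²`. -/
def G (α β γ : ℝ) (I : Set (Fin 2 × ℕ)) (w : Fin 2 × ℕ → ℝ) (Q q : L2) : ℝ :=
  ∑' k : I, w k * (lam α β γ q k - lam α β γ Q k) ^ 2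

end

end SturmLiouville

/-!
# Critical points of the least squares functional for two Sturm–Liouville spectra

The derivative of an eigenvalue `λ` in a direction `h` is `∫ h g²`, with `g` the normalized
eigenfunction (`hasDerivAt_eigenvalue_line`). So the gradient of the functional `G` at `q` is the
series `F = 2 ∑ ω_k (λ_{q,k} - λ_{Q,k}) g_k²`, and a critical point with `G(q) > 0` would give a
nontrivial linear relation between the squares `g_k²` of the eigenfunctions of two spectra. There is
none (`eq_zero_of_tsum_sqEigenFun_eq_zero`). Let `g` be the eigenfunction with index `k`, and `h` a
solution for the same spectral parameter that satisfies the *other* boundary condition at `1`. By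
Lagrange's identity, the integral of `(g h)'` against the square `f²` of an eigenfunction with any
other index equals its boundary terms in `f²`, whereas for `f = g` the Wronskian of `g` and `h`, which
is not zero, appears in addition (`exists_biorthogonal`). Since `F` vanishes on all of `[0,1]`, the
boundary terms sum to zero, and only the coefficient with index `k` is left.

The analysis behind this uses only that potentials are integrable.

* Eigenvalues are counted with the Prüfer angle. It exists by a contraction argument
  (`exists_isPruferAngle`), and the difference of two Prüfer angles satisfies a linear equation, from
  which follow its Lipschitz dependence on the potential in `L¹` and its strict monotonicity in the
  spectral parameter. An eigenvalue is a parameter at which the angle at `1` attains a level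
  `-b + k π`, and the lowest level attained is the same for all potentials (`firstIndex`), since a
  potential can be deformed to zero within a range free of eigenvalues. Hence the `n`-th eigenvalue
  is continuous along lines of potentials, and Lagrange's identity for the eigenfunctions at two
  points of the line gives its derivative.
* The squares `g_k²` are bounded uniformly in `k` (`IsSol.sq_le_supBound`). Therefore the differences
  `λ_{q,k} - λ_{Q,k}` are bounded, all the series converge absolutely as soon as `∑ ω_k < ∞`, and
  `G` can be differentiated term by term. Nothing about the asymptotics of eigenvalues is needed.

The converse implications hold because `G ≥ 0`, and at a local minimum all directional derivatives
vanish.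
-/

open Filter Topology
open scoped NNReal

namespace SturmLiouville

/-! ### Absolutely continuous functions on the unit interval -/

/-- `f` is absolutely continuous on `[0,1]` with derivative `f'` almost everywhere. -/
structure HasACDeriv (f f' : ℝ → ℝ) : Prop where
  /-- absolute continuity on the closed interval -/
  ac : AbsolutelyContinuousOnInterval f 0 1
  /-- the derivative at almost every interior point -/
  ae : ∀ᵐ x, x ∈ Ioo (0 : ℝ) 1 → HasDerivAt f (f' x) x

theorem ae_uIoc_of_ae_Ioo {P : ℝ → Prop} (h : ∀ᵐ x, x ∈ Ioo (0 : ℝ) 1 → P x) {a b : ℝ}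
    (ha : a ∈ Icc (0 : ℝ) 1) (hb : b ∈ Icc (0 : ℝ) 1) : ∀ᵐ x, x ∈ uIoc a b → P x := by
  have h1 : ∀ᵐ x : ℝ, x ≠ 1 := Measure.ae_ne volume 1
  filter_upwards [h, h1] with x hx hx1 hxab
  refine hx ⟨?_, lt_of_le_of_ne ?_ hx1⟩
  · rcases mem_uIoc.1 hxab with h | h
    · exact ha.1.trans_lt h.1
    · exact hb.1.trans_lt h.1
  · rcases mem_uIoc.1 hxab with h | h
    · exact h.2.trans hb.2
    · exact h.2.trans ha.2

theorem _root_.IntervalIntegrable.mono_unit {f : ℝ → ℝ} (hf : IntervalIntegrable f volume 0 1)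
    {a b : ℝ} (ha : a ∈ Icc (0 : ℝ) 1) (hb : b ∈ Icc (0 : ℝ) 1) :
    IntervalIntegrable f volume a b :=
  hf.mono_set (by rw [uIcc_of_le zero_le_one]; exact uIcc_subset_Icc ha hb)

theorem zero_mem_unit : (0 : ℝ) ∈ Icc (0 : ℝ) 1 := ⟨le_rfl, zero_le_one⟩

theorem one_mem_unit : (1 : ℝ) ∈ Icc (0 : ℝ) 1 := ⟨zero_le_one, le_rfl⟩

/-- A product of an integrable function with a function continuous on `[0,1]` is integrable. -/
theorem _root_.IntervalIntegrable.mul_contOn {f g : ℝ → ℝ} (hf : IntervalIntegrable f volume 0 1)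
    (hg : ContinuousOn g (Icc 0 1)) : IntervalIntegrable (fun x => f x * g x) volume 0 1 :=
  hf.mul_continuousOn (by rwa [uIcc_of_le zero_le_one])

theorem _root_.ContinuousOn.intervalIntegrable_unit {g : ℝ → ℝ} (hg : ContinuousOn g (Icc 0 1)) :
    IntervalIntegrable g volume 0 1 :=
  ContinuousOn.intervalIntegrable (by rwa [uIcc_of_le zero_le_one])

namespace HasACDeriv

variable {f f' g g' : ℝ → ℝ}

theorem continuousOn (hf : HasACDeriv f f') : ContinuousOn f (Icc 0 1) := by
  simpa [uIcc_of_le] using hf.ac.continuousOn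

theorem ae_deriv_eq (hf : HasACDeriv f f') {a b : ℝ} (ha : a ∈ Icc (0 : ℝ) 1)
    (hb : b ∈ Icc (0 : ℝ) 1) : ∀ᵐ x, x ∈ uIoc a b → deriv f x = f' x := by
  filter_upwards [ae_uIoc_of_ae_Ioo hf.ae ha hb] with x hx hx' using (hx hx').deriv

theorem intervalIntegrable (hf : HasACDeriv f f') : IntervalIntegrable f' volume 0 1 :=
  hf.ac.intervalIntegrable_deriv.congr_ae
    ((ae_restrict_iff' measurableSet_uIoc).2 (hf.ae_deriv_eq zero_mem_unit one_mem_unit))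

theorem integral_eq (hf : HasACDeriv f f') {a b : ℝ} (ha : a ∈ Icc (0 : ℝ) 1)
    (hb : b ∈ Icc (0 : ℝ) 1) : ∫ x in a..b, f' x = f b - f a := by
  rw [← (hf.ac.mono (c := a) (d := b) (by
    rw [uIcc_of_le zero_le_one]; exact uIcc_subset_Icc ha hb)).integral_deriv_eq_sub]
  refine intervalIntegral.integral_congr_ae ?_
  filter_upwards [hf.ae_deriv_eq ha hb] with x hx hx' using (hx hx').symm

theorem congr (hf : HasACDeriv f f') (h : ∀ᵐ x, x ∈ Ioo (0 : ℝ) 1 → f' x = g' x) :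
    HasACDeriv f g' :=
  ⟨hf.ac, by filter_upwards [hf.ae, h] with x h1 h2 hx using h2 hx ▸ h1 hx⟩

theorem congr' (hf : HasACDeriv f f') (h : ∀ x, f' x = g' x) : HasACDeriv f g' :=
  hf.congr (ae_of_all _ fun x _ => h x)

/-- Functions that are given by an indefinite integral are absolutely continuous. -/
theorem of_integral (hg : IntervalIntegrable g volume 0 1)
    (h : ∀ x ∈ Icc (0 : ℝ) 1, f x = f 0 + ∫ s in (0 : ℝ)..x, g s) : HasACDeriv f g := by
  have hac := hg.absolutelyContinuousOnInterval_intervalIntegral (c := 0) (by simp)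
  refine ⟨?_, ?_⟩
  · rw [absolutelyContinuousOnInterval_iff] at hac ⊢
    intro ε hε
    obtain ⟨δ, hδ, H⟩ := hac ε hε
    refine ⟨δ, hδ, fun E hE hE' => ?_⟩
    refine lt_of_eq_of_lt (Finset.sum_congr rfl fun i hi => ?_) (H E hE hE')
    have := hE.1 i hi
    rw [uIcc_of_le zero_le_one] at this
    rw [h _ this.1, h _ this.2, dist_add_left]
  · filter_upwards [hg.ae_hasDerivAt_integral] with x hx hx'
    have hx1 := hx (by rw [uIcc_of_le zero_le_one]; exact Ioo_subset_Icc_self hx') 0 (by simp)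
    refine (hx1.const_add (f 0)).congr_of_eventuallyEq ?_
    filter_upwards [Ioo_mem_nhds hx'.1 hx'.2] with y hy using h y (Ioo_subset_Icc_self hy)

theorem integral (hg : IntervalIntegrable g volume 0 1) :
    HasACDeriv (fun x => ∫ s in (0 : ℝ)..x, g s) g :=
  of_integral hg fun x _ => by simp

theorem add (hf : HasACDeriv f f') (hg : HasACDeriv g g') :
    HasACDeriv (fun x => f x + g x) (fun x => f' x + g' x) :=
  ⟨hf.ac.add hg.ac, by filter_upwards [hf.ae, hg.ae] with x h1 h2 hx using (h1 hx).add (h2 hx)⟩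

theorem sub (hf : HasACDeriv f f') (hg : HasACDeriv g g') :
    HasACDeriv (fun x => f x - g x) (fun x => f' x - g' x) :=
  ⟨hf.ac.sub hg.ac, by filter_upwards [hf.ae, hg.ae] with x h1 h2 hx using (h1 hx).sub (h2 hx)⟩

theorem mul (hf : HasACDeriv f f') (hg : HasACDeriv g g') :
    HasACDeriv (fun x => f x * g x) (fun x => f' x * g x + f x * g' x) :=
  ⟨hf.ac.mul hg.ac, by filter_upwards [hf.ae, hg.ae] with x h1 h2 hx using (h1 hx).mul (h2 hx)⟩

theorem const_mul (c : ℝ) (hf : HasACDeriv f f') :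
    HasACDeriv (fun x => c * f x) (fun x => c * f' x) :=
  ⟨hf.ac.const_mul c, by filter_upwards [hf.ae] with x h1 hx using (h1 hx).const_mul c⟩

/-- Chain rule: a continuously differentiable function of an absolutely continuous one. -/
theorem comp {φ φ' : ℝ → ℝ} (hφ : ∀ y, HasDerivAt φ (φ' y) y) (hφ' : Continuous φ')
    (hf : HasACDeriv f f') : HasACDeriv (fun x => φ (f x)) (fun x => φ' (f x) * f' x) := by
  refine ⟨?_, by filter_upwards [hf.ae] with x h1 hx using (hφ _).comp x (h1 hx)⟩
  obtain ⟨M, hM⟩ := hf.ac.exists_bound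
  have hd : deriv φ = φ' := funext fun y => (hφ y).deriv
  have hC1 : ContDiff ℝ 1 φ :=
    contDiff_one_iff_deriv.2 ⟨fun y => (hφ y).differentiableAt, hd ▸ hφ'⟩
  -- `φ` is Lipschitz on the bounded range of `f`.
  obtain ⟨K, hK⟩ := hC1.contDiffOn.exists_lipschitzOnWith (s := Icc (-M) M) (by decide)
    (convex_Icc _ _) isCompact_Icc
  have hac := hf.ac
  rw [absolutelyContinuousOnInterval_iff] at hac ⊢
  intro ε hε
  obtain ⟨δ, hδ, H⟩ := hac (ε / (K + 1)) (by positivity)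
  refine ⟨δ, hδ, fun E hE hE' => ?_⟩
  have hle : ∀ i ∈ Finset.range E.1, dist (φ (f (E.2 i).1)) (φ (f (E.2 i).2)) ≤
      K * dist (f (E.2 i).1) (f (E.2 i).2) := fun i hi =>
    hK.dist_le_mul _ (abs_le.1 (hM _ (hE.1 i hi).1)) _ (abs_le.1 (hM _ (hE.1 i hi).2))
  calc _ ≤ ∑ i ∈ Finset.range E.1, K * dist (f (E.2 i).1) (f (E.2 i).2) := Finset.sum_le_sum hle
    _ = K * ∑ i ∈ Finset.range E.1, dist (f (E.2 i).1) (f (E.2 i).2) := by rw [Finset.mul_sum]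
    _ ≤ K * (ε / (K + 1)) := by gcongr; exact (H E hE hE').le
    _ < (K + 1) * (ε / (K + 1)) := by gcongr; linarith
    _ = ε := by field_simp

theorem exp (hf : HasACDeriv f f') :
    HasACDeriv (fun x => Real.exp (f x)) (fun x => Real.exp (f x) * f' x) :=
  hf.comp Real.hasDerivAt_exp Real.continuous_exp

theorem sin (hf : HasACDeriv f f') :
    HasACDeriv (fun x => Real.sin (f x)) (fun x => Real.cos (f x) * f' x) :=
  hf.comp Real.hasDerivAt_sin Real.continuous_cos

theorem cos (hf : HasACDeriv f f') :
    HasACDeriv (fun x => Real.cos (f x)) (fun x => -Real.sin (f x) * f' x) :=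
  hf.comp Real.hasDerivAt_cos Real.continuous_sin.neg

theorem le_of_nonneg (hf : HasACDeriv f f') (h : ∀ᵐ x, x ∈ Ioo (0 : ℝ) 1 → 0 ≤ f' x) {a b : ℝ}
    (ha : a ∈ Icc (0 : ℝ) 1) (hb : b ∈ Icc (0 : ℝ) 1) (hab : a ≤ b) : f a ≤ f b := by
  have := hf.integral_eq ha hb
  have h2 : 0 ≤ ∫ x in a..b, f' x := by
    refine intervalIntegral.integral_nonneg_of_ae_restrict hab ?_
    refine (ae_restrict_iff' measurableSet_Icc).2 ?_
    have := ae_uIoc_of_ae_Ioo h ha hb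
    have h1 : ∀ᵐ x : ℝ, x ≠ a := Measure.ae_ne volume a
    filter_upwards [this, h1] with x hx hx1 hx2
    exact hx (by rw [uIoc_of_le hab]; exact ⟨lt_of_le_of_ne hx2.1 hx1.symm, hx2.2⟩)
  linarith

theorem eq_of_zero (hf : HasACDeriv f fun _ => 0) {a b : ℝ}
    (ha : a ∈ Icc (0 : ℝ) 1) (hb : b ∈ Icc (0 : ℝ) 1) : f a = f b := by
  have := hf.integral_eq ha hb
  simp at this; linarith

/-- Grönwall's inequality, in a form that compares the values at any two points. -/
theorem gronwall {k : ℝ → ℝ} (hk : IntervalIntegrable k volume 0 1) (hk0 : ∀ x, 0 ≤ k x)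
    (hf : HasACDeriv f f') (hf0 : ∀ x ∈ Icc (0 : ℝ) 1, 0 ≤ f x)
    (h : ∀ᵐ x, x ∈ Ioo (0 : ℝ) 1 → |f' x| ≤ k x * f x) {a b : ℝ}
    (ha : a ∈ Icc (0 : ℝ) 1) (hb : b ∈ Icc (0 : ℝ) 1) :
    f a ≤ Real.exp (∫ x in (0 : ℝ)..1, k x) * f b := by
  have hK := integral hk
  set K : ℝ → ℝ := fun x => ∫ s in (0 : ℝ)..x, k s with hKdef
  have hKab : ∀ {a b}, a ∈ Icc (0 : ℝ) 1 → b ∈ Icc (0 : ℝ) 1 → a ≤ b → K b - K a ≤ K 1 := by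
    intro a b ha hb hab
    have h1 := hK.le_of_nonneg (ae_of_all _ fun x _ => hk0 x) zero_mem_unit ha ha.1
    have h2 := hK.le_of_nonneg (ae_of_all _ fun x _ => hk0 x) hb one_mem_unit hb.2
    have h3 : K 0 = 0 := by simp [hKdef]
    linarith
  have key : ∀ {x y e : ℝ}, 0 ≤ y → Real.exp (e) ≤ Real.exp (K 1) → x ≤ Real.exp e * y →
      x ≤ Real.exp (K 1) * y := fun hy he hx => hx.trans (by gcongr)
  have hpt : ∀ {c d x y : ℝ}, Real.exp c * x ≤ Real.exp d * y → x ≤ Real.exp (d - c) * y := by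
    intro c d x y hh
    rw [Real.exp_sub, div_mul_eq_mul_div, le_div_iff₀ (Real.exp_pos _)]; linarith
  -- `exp K * f` is increasing and `exp (-K) * f` is decreasing.
  rcases le_total a b with hab | hab
  · have h1 := (hK.exp.mul hf).le_of_nonneg (by
      filter_upwards [h] with x hx hx'
      have := (abs_le.1 (hx hx')).1
      have := Real.exp_pos (K x)
      rw [mul_assoc, ← mul_add]
      exact mul_nonneg this.le (by linarith)) ha hb hab
    exact key (hf0 b hb) (Real.exp_le_exp.2 (hKab ha hb hab)) (hpt h1)
  · have h1 := (((hK.const_mul (-1)).exp.mul hf).const_mul (-1)).le_of_nonneg (by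
      filter_upwards [h] with x hx hx'
      have h2 := (abs_le.1 (hx hx')).2
      have h3 := mul_nonneg (Real.exp_pos (-1 * K x)).le (sub_nonneg.2 h2)
      linarith) hb ha hab
    refine key (hf0 b hb) (Real.exp_le_exp.2 ?_) (hpt (c := -1 * K a) (d := -1 * K b) (by linarith))
    linarith [hKab hb ha hab]

end HasACDeriv

theorem abs_integral_le_unit {f g : ℝ → ℝ} (hg : IntervalIntegrable g volume 0 1)
    (h : ∀ s ∈ Icc (0 : ℝ) 1, |f s| ≤ g s) {x : ℝ} (hx : x ∈ Icc (0 : ℝ) 1) :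
    |∫ s in (0 : ℝ)..x, f s| ≤ ∫ s in (0 : ℝ)..1, g s := by
  have h1 : |∫ s in (0 : ℝ)..x, f s| ≤ ∫ s in (0 : ℝ)..x, g s := by
    rw [← Real.norm_eq_abs]
    refine intervalIntegral.norm_integral_le_of_norm_le hx.1 (ae_of_all _ fun s hs => ?_)
      (hg.mono_unit zero_mem_unit hx)
    exact h s ⟨hs.1.le, hs.2.trans hx.2⟩
  refine h1.trans ?_
  have h2 := intervalIntegral.integral_add_adjacent_intervals (hg.mono_unit zero_mem_unit hx)
    (hg.mono_unit hx one_mem_unit)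
  have h3 : 0 ≤ ∫ s in x..1, g s := intervalIntegral.integral_nonneg hx.2 fun s hs =>
    (abs_nonneg _).trans (h s ⟨hx.1.trans hs.1, hs.2⟩)
  linarith

/-- A linear equation `δ' = A δ + g`, multiplied by its integrating factor. -/
theorem HasACDeriv.integrating_factor {δ A g : ℝ → ℝ} (hA : IntervalIntegrable A volume 0 1)
    (hδ : HasACDeriv δ fun x => A x * δ x + g x) :
    HasACDeriv (fun x => δ x * Real.exp (-1 * ∫ s in (0 : ℝ)..x, A s))
      fun x => g x * Real.exp (-1 * ∫ s in (0 : ℝ)..x, A s) :=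
  (hδ.mul ((HasACDeriv.integral hA).const_mul (-1)).exp).congr' fun x => by ring

/-! ### The Prüfer angle -/

/-- `θ` is a Prüfer angle for the equation `u'' = p u`: if `(u, u') = r (sin θ, cos θ)`, then
`θ' = cos² θ - p sin² θ`. -/
def IsPruferAngle (p θ : ℝ → ℝ) : Prop :=
  HasACDeriv θ fun x => 1 - (1 + p x) * Real.sin (θ x) ^ 2

theorem sin_sq_sub_sin_sq (a b : ℝ) :
    Real.sin b ^ 2 - Real.sin a ^ 2 = Real.sin (a + b) * Real.sinc (b - a) * (b - a) := by
  have h : Real.sinc (b - a) * (b - a) = Real.sin (b - a) := by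
    rcases eq_or_ne (b - a) 0 with h | h
    · simp [h]
    · rw [Real.sinc_of_ne_zero h]; field_simp
  rw [mul_assoc, h, Real.sin_add, Real.sin_sub]
  nlinarith [Real.sin_sq_add_cos_sq a, Real.sin_sq_add_cos_sq b]

theorem abs_sin_sq_sub_sin_sq_le (a b : ℝ) :
    |Real.sin a ^ 2 - Real.sin b ^ 2| ≤ |a - b| := by
  rw [sin_sq_sub_sin_sq, abs_mul, abs_mul]
  have h1 := Real.abs_sin_le_one (b + a)
  have h2 := Real.abs_sinc_le_one (a - b)
  have h3 := mul_le_one₀ h1 (abs_nonneg _) h2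
  exact mul_le_of_le_one_left (abs_nonneg _) h3

/-- Existence of Prüfer angles for integrable `p`: the integral equation has a solution because,
in the norm with weight `exp (-2 ∫ |1 + p|)`, its right-hand side is a contraction. -/
theorem exists_isPruferAngle {p : ℝ → ℝ} (hp : IntervalIntegrable p volume 0 1) (θ₀ : ℝ) :
    ∃ θ : ℝ → ℝ, θ 0 = θ₀ ∧ IsPruferAngle p θ := by
  have hp1 : IntervalIntegrable (fun x => 1 + p x) volume 0 1 := by
    simpa using (intervalIntegrable_const (c := (1 : ℝ))).add hp
  have hk : IntervalIntegrable (fun x => |1 + p x|) volume 0 1 := hp1.abs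
  have hK := HasACDeriv.integral hk
  set K : ℝ → ℝ := fun x => ∫ s in (0 : ℝ)..x, |1 + p s| with hKdef
  have hK2 := (hK.const_mul 2).exp
  have hKn := (hK.const_mul (-2)).exp
  -- The unknown is `w = exp (-2 K) θ`, and `y w` is the angle that `w` encodes.
  let X := C(Icc (0 : ℝ) 1, ℝ)
  let y : X → ℝ → ℝ := fun w s => Real.exp (2 * K s) * w (projIcc 0 1 zero_le_one s)
  have hy : ∀ w, ContinuousOn (y w) (Icc 0 1) := fun w =>
    hK2.continuousOn.mul (w.continuous.comp continuous_projIcc).continuousOn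
  let F : X → ℝ → ℝ := fun w s => 1 - (1 + p s) * Real.sin (y w s) ^ 2
  have hF : ∀ w, IntervalIntegrable (F w) volume 0 1 := fun w =>
    intervalIntegrable_const.sub
      (hp1.mul_contOn ((Real.continuous_sin.comp_continuousOn (hy w)).pow 2))
  let T : X → X := fun w =>
    ⟨(Icc (0 : ℝ) 1).domRestrict fun x => Real.exp (-2 * K x) * (θ₀ + ∫ s in (0 : ℝ)..x, F w s),
      continuousOn_iff_continuous_domRestrict.1 (hKn.continuousOn.mul
        (continuousOn_const.add (HasACDeriv.integral (hF w)).continuousOn))⟩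
  have hT : ∀ w (x : Icc (0 : ℝ) 1), T w x =
    Real.exp (-2 * K x) * (θ₀ + ∫ s in (0 : ℝ)..x, F w s) := fun w x => rfl
  have hcontr : ContractingWith (1 / 2 : ℝ≥0) T := by
    refine ⟨by rw [div_lt_one] <;> norm_num, LipschitzWith.of_dist_le_mul fun w₁ w₂ => ?_⟩
    refine (ContinuousMap.dist_le (by positivity)).2 fun x => ?_
    have hx := x.2
    rw [hT, hT, Real.dist_eq, ← mul_sub, add_sub_add_left_eq_sub,
      ← intervalIntegral.integral_sub ((hF w₁).mono_unit zero_mem_unit hx)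
        ((hF w₂).mono_unit zero_mem_unit hx), abs_mul, abs_of_pos (Real.exp_pos _)]
    -- The bounding integrand is the derivative of `exp (2 K) / 2` times the distance.
    have hb : |∫ s in (0 : ℝ)..x, (F w₁ s - F w₂ s)| ≤
        ∫ s in (0 : ℝ)..x, dist w₁ w₂ / 2 * (Real.exp (2 * K s) * (2 * |1 + p s|)) := by
      rw [← Real.norm_eq_abs]
      refine intervalIntegral.norm_integral_le_of_norm_le hx.1 (ae_of_all _ fun s hs => ?_)
        ((hK2.intervalIntegrable.mono_unit zero_mem_unit hx).const_mul _)
      have h1 : F w₁ s - F w₂ s =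
        (1 + p s) * (Real.sin (y w₂ s) ^ 2 - Real.sin (y w₁ s) ^ 2) := by simp only [F]; ring
      rw [h1, norm_mul, Real.norm_eq_abs, Real.norm_eq_abs]
      have h2 := abs_sin_sq_sub_sin_sq_le (y w₂ s) (y w₁ s)
      have h3 : |y w₂ s - y w₁ s| ≤ Real.exp (2 * K s) * dist w₁ w₂ := by
        simp only [y]
        rw [← mul_sub, abs_mul, abs_of_pos (Real.exp_pos _), ← Real.dist_eq, dist_comm]
        gcongr
        exact ContinuousMap.dist_apply_le_dist _
      calc _ ≤ |1 + p s| * (Real.exp (2 * K s) * dist w₁ w₂) := by gcongr; exact h2.trans h3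
        _ = _ := by ring
    rw [intervalIntegral.integral_const_mul, hK2.integral_eq zero_mem_unit hx] at hb
    have hK0 : K 0 = 0 := by simp [hKdef]
    have he : Real.exp (-2 * K x) * Real.exp (2 * K x) = 1 := by
      rw [← Real.exp_add]; simp
    calc _ ≤ Real.exp (-2 * K x) * (dist w₁ w₂ / 2 * (Real.exp (2 * K x) - Real.exp (2 * K 0))) := by
          gcongr
      _ = dist w₁ w₂ / 2 * (1 - Real.exp (-2 * K x)) := by
          rw [hK0, mul_zero, Real.exp_zero]; linear_combination (dist w₁ w₂ / 2) * he
      _ ≤ dist w₁ w₂ / 2 * 1 := by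
          gcongr; linarith [Real.exp_pos (-2 * K x)]
      _ = _ := by push_cast; ring
  obtain ⟨w, hw⟩ : ∃ w, T w = w := ⟨_, hcontr.fixedPoint_isFixedPt⟩
  have hyw : ∀ x ∈ Icc (0 : ℝ) 1, y w x = θ₀ + ∫ s in (0 : ℝ)..x, F w s := by
    intro x hx
    have h1 : w ⟨x, hx⟩ = Real.exp (-2 * K x) * (θ₀ + ∫ s in (0 : ℝ)..x, F w s) := by
      rw [← hT w ⟨x, hx⟩, hw]
    simp only [y]
    rw [projIcc_of_mem _ hx, h1, ← mul_assoc, ← Real.exp_add]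
    simp
  have hy0 : y w 0 = θ₀ := by rw [hyw 0 zero_mem_unit]; simp
  exact ⟨y w, hy0, HasACDeriv.of_integral (hF w) fun x hx => by rw [hy0]; exact hyw x hx⟩

namespace IsPruferAngle

variable {p p₁ p₂ θ θ₁ θ₂ : ℝ → ℝ}

theorem continuousOn (h : IsPruferAngle p θ) : ContinuousOn θ (Icc 0 1) :=
  HasACDeriv.continuousOn h

/-- The coefficient `A` in the linear equation `δ' = A δ + (p₁ - p₂) sin² θ₁` for the difference
`δ = θ₂ - θ₁` of two Prüfer angles. -/
noncomputable def linCoeff (p₂ θ₁ θ₂ : ℝ → ℝ) (x : ℝ) : ℝ :=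
  (1 + p₂ x) * (-(Real.sin (θ₁ x + θ₂ x) * Real.sinc (θ₂ x - θ₁ x)))

theorem abs_linCoeff_le (p₂ θ₁ θ₂ : ℝ → ℝ) (x : ℝ) : |linCoeff p₂ θ₁ θ₂ x| ≤ |1 + p₂ x| := by
  rw [linCoeff, abs_mul, abs_neg, abs_mul]
  exact mul_le_of_le_one_right (abs_nonneg _)
    (mul_le_one₀ (Real.abs_sin_le_one _) (abs_nonneg _) (Real.abs_sinc_le_one _))

theorem intervalIntegrable_linCoeff (hp₂ : IntervalIntegrable p₂ volume 0 1)
    (h₁ : ContinuousOn θ₁ (Icc 0 1)) (h₂ : ContinuousOn θ₂ (Icc 0 1)) :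
    IntervalIntegrable (linCoeff p₂ θ₁ θ₂) volume 0 1 := by
  refine IntervalIntegrable.mul_contOn (f := fun x => 1 + p₂ x) ?_ ?_
  · simpa using (intervalIntegrable_const (c := (1 : ℝ))).add hp₂
  · exact ((Real.continuous_sin.comp_continuousOn (h₁.add h₂)).mul
      (Real.continuous_sinc.comp_continuousOn (h₂.sub h₁))).neg

theorem hasACDeriv_sub (h₁ : IsPruferAngle p₁ θ₁) (h₂ : IsPruferAngle p₂ θ₂) :
    HasACDeriv (fun x => θ₂ x - θ₁ x) fun x =>
      linCoeff p₂ θ₁ θ₂ x * (θ₂ x - θ₁ x) + (p₁ x - p₂ x) * Real.sin (θ₁ x) ^ 2 :=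
  (HasACDeriv.sub h₂ h₁).congr' fun x => by
    have := sin_sq_sub_sin_sq (θ₁ x) (θ₂ x)
    rw [linCoeff]; linear_combination (-(1 + p₂ x)) * this

/-- Lipschitz dependence of the Prüfer angle on the potential, in the norm of `L¹`. -/
theorem abs_sub_le (hp₁ : IntervalIntegrable p₁ volume 0 1)
    (hp₂ : IntervalIntegrable p₂ volume 0 1)
    (h₁ : IsPruferAngle p₁ θ₁) (h₂ : IsPruferAngle p₂ θ₂) (h0 : θ₁ 0 = θ₂ 0) {x : ℝ}
    (hx : x ∈ Icc (0 : ℝ) 1) :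
    |θ₂ x - θ₁ x| ≤ Real.exp (2 * ∫ s in (0 : ℝ)..1, |1 + p₂ s|) *
      ∫ s in (0 : ℝ)..1, |p₁ s - p₂ s| := by
  have hp1 : IntervalIntegrable (fun x => 1 + p₂ x) volume 0 1 := by
    simpa using (intervalIntegrable_const (c := (1 : ℝ))).add hp₂
  have hA := intervalIntegrable_linCoeff hp₂ h₁.continuousOn h₂.continuousOn
  have hI := (h₁.hasACDeriv_sub h₂).integrating_factor hA
  set N := ∫ s in (0 : ℝ)..1, |1 + p₂ s|
  set B : ℝ → ℝ := fun x => ∫ s in (0 : ℝ)..x, linCoeff p₂ θ₁ θ₂ s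
  have hB : ∀ x ∈ Icc (0 : ℝ) 1, |B x| ≤ N := fun x hx =>
    abs_integral_le_unit hp1.abs (fun s _ => abs_linCoeff_le _ _ _ s) hx
  have h3 := hI.integral_eq zero_mem_unit hx
  rw [h0, sub_self, zero_mul, sub_zero] at h3
  have h4 := abs_integral_le_unit (f := fun x => (p₁ x - p₂ x) * Real.sin (θ₁ x) ^ 2 *
      Real.exp (-1 * B x)) ((hp₁.sub hp₂).abs.const_mul (Real.exp N)) (fun s hs => by
    rw [abs_mul, abs_mul, abs_of_pos (Real.exp_pos _), mul_comm (Real.exp N)]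
    have h5 : |Real.sin (θ₁ s) ^ 2| ≤ 1 := by
      rw [abs_of_nonneg (sq_nonneg _)]; exact Real.sin_sq_le_one _
    have h6 : Real.exp (-1 * B s) ≤ Real.exp N :=
      Real.exp_le_exp.2 (by linarith [(abs_le.1 (hB s hs)).1])
    have h7 : |p₁ s - p₂ s| * |Real.sin (θ₁ s) ^ 2| ≤ |p₁ s - p₂ s| :=
      mul_le_of_le_one_right (abs_nonneg _) h5
    exact mul_le_mul h7 h6 (Real.exp_pos _).le (abs_nonneg _)) hx
  rw [h3, intervalIntegral.integral_const_mul, abs_mul, abs_of_pos (Real.exp_pos _)] at h4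
  have h8 : θ₂ x - θ₁ x = Real.exp (B x) * ((θ₂ x - θ₁ x) * Real.exp (-1 * B x)) := by
    rw [mul_left_comm, ← Real.exp_add]; simp
  rw [h8, abs_mul, abs_mul, abs_of_pos (Real.exp_pos _), abs_of_pos (Real.exp_pos _), two_mul,
    Real.exp_add, mul_assoc]
  exact mul_le_mul (Real.exp_le_exp.2 (abs_le.1 (hB x hx)).2) h4 (by positivity)
    (Real.exp_pos _).le

/-- The sine of a Prüfer angle is not identically zero, since `θ' = 1` where it vanishes. -/
theorem exists_sin_ne_zero (h : IsPruferAngle p θ) :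
    ∃ x ∈ Icc (0 : ℝ) 1, Real.sin (θ x) ≠ 0 := by
  by_contra! H
  have h1 : HasACDeriv θ fun _ => 1 := HasACDeriv.congr h (ae_of_all _ fun x hx => by
    rw [H x (Ioo_subset_Icc_self hx)]; simp)
  have h2 := h1.integral_eq zero_mem_unit one_mem_unit
  have h3 : θ 1 = θ 0 + 1 := by simp at h2; linarith
  have h4 := H 1 one_mem_unit
  have h5 := H 0 zero_mem_unit
  rw [h3, Real.sin_add, h5, zero_mul, zero_add, mul_eq_zero] at h4
  have h6 := Real.sin_sq_add_cos_sq (θ 0)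
  have h7 : 0 < Real.sin 1 := Real.sin_pos_of_pos_of_lt_pi one_pos (by linarith [Real.pi_gt_three])
  rcases h4 with h4 | h4
  · rw [h4, h5] at h6; simp at h6
  · exact h7.ne' h4

/-- Strict monotonicity: lowering the potential by a positive constant increases the angle. -/
theorem lt_of_sub_const {c : ℝ} (hc : 0 < c) (hp₂ : IntervalIntegrable p₂ volume 0 1)
    (h₁ : IsPruferAngle p₁ θ₁) (h₂ : IsPruferAngle p₂ θ₂) (h0 : θ₁ 0 = θ₂ 0)
    (h : ∀ x, p₁ x - p₂ x = c) : θ₁ 1 < θ₂ 1 := by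
  have hA := intervalIntegrable_linCoeff hp₂ h₁.continuousOn h₂.continuousOn
  have hI := (h₁.hasACDeriv_sub h₂).integrating_factor hA
  set B : ℝ → ℝ := fun x => ∫ s in (0 : ℝ)..x, linCoeff p₂ θ₁ θ₂ s
  have hBc : ContinuousOn B (Icc 0 1) := (HasACDeriv.integral hA).continuousOn
  have h3 := hI.integral_eq zero_mem_unit one_mem_unit
  rw [h0, sub_self, zero_mul, sub_zero] at h3
  have h4 : 0 < ∫ x in (0 : ℝ)..1, (p₁ x - p₂ x) * Real.sin (θ₁ x) ^ 2 * Real.exp (-1 * B x) := by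
    obtain ⟨x, hx, hsx⟩ := h₁.exists_sin_ne_zero
    refine intervalIntegral.integral_pos one_pos ?_ (fun x _ => ?_) ⟨x, hx, ?_⟩
    · simp only [h]
      exact (continuousOn_const.mul ((Real.continuous_sin.comp_continuousOn h₁.continuousOn).pow 2)).mul
        (Real.continuous_exp.comp_continuousOn (continuousOn_const.mul hBc))
    · rw [h]; positivity
    · rw [h]; positivity
  rw [h3] at h4
  exact sub_pos.1 (pos_of_mul_pos_left h4 (Real.exp_pos _).le)

end IsPruferAngle

theorem intervalIntegrable_one_add {p : ℝ → ℝ} (hp : IntervalIntegrable p volume 0 1) :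
    IntervalIntegrable (fun x => 1 + p x) volume 0 1 := by
  simpa using (intervalIntegrable_const (c := (1 : ℝ))).add hp

theorem intervalIntegrable_sub_const {p : ℝ → ℝ} (hp : IntervalIntegrable p volume 0 1) (μ : ℝ) :
    IntervalIntegrable (fun x => p x - μ) volume 0 1 :=
  hp.sub intervalIntegrable_const

theorem one_le_cos_sq_add {μ : ℝ} (hμ : 1 ≤ μ) (y : ℝ) :
    1 ≤ Real.cos y ^ 2 + μ * Real.sin y ^ 2 := by
  nlinarith [Real.sin_sq_add_cos_sq y, sq_nonneg (Real.sin y)]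

theorem continuous_inv_cos_sq_add {μ : ℝ} (hμ : 1 ≤ μ) :
    Continuous fun y => (Real.cos y ^ 2 + μ * Real.sin y ^ 2)⁻¹ :=
  Continuous.inv₀ (by fun_prop) fun y => (one_pos.trans_le (one_le_cos_sq_add hμ y)).ne'

theorem tendsto_integral_inv_cos_sq_add (c d : ℝ) :
    Tendsto (fun μ : ℝ => ∫ y in c..d, (Real.cos y ^ 2 + μ * Real.sin y ^ 2)⁻¹) atTop (𝓝 0) := by
  have h0 : (∫ y in c..d, (0 : ℝ)) = 0 := by simp
  rw [← h0]
  refine intervalIntegral.tendsto_integral_filter_of_dominated_convergence (fun _ => 1) ?_ ?_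
    intervalIntegrable_const ?_
  · filter_upwards [eventually_ge_atTop 1] with μ hμ
    exact (continuous_inv_cos_sq_add hμ).aestronglyMeasurable
  · filter_upwards [eventually_ge_atTop 1] with μ hμ
    refine ae_of_all _ fun y _ => ?_
    have := one_le_cos_sq_add hμ y
    rw [Real.norm_eq_abs, abs_of_pos (by positivity)]
    exact inv_le_one_of_one_le₀ this
  · have hc : {y : ℝ | Real.sin y = 0}.Countable := by
      refine (countable_range fun n : ℤ => (n : ℝ) * Real.pi).mono fun y hy => ?_
      exact Real.sin_eq_zero_iff.1 hy
    filter_upwards [hc.ae_notMem volume] with y hy _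
    have hs : 0 < Real.sin y ^ 2 := by
      have : Real.sin y ≠ 0 := hy
      positivity
    exact tendsto_inv_atTop_zero.comp
      (tendsto_atTop_add_const_left _ _ (tendsto_id.atTop_mul_const hs))

/-- The Prüfer angle at the right endpoint is unbounded for large spectral parameter: measured
with the density `1 / (cos² + μ sin²)`, the angle advances by about `1`, while the measure of
any fixed interval tends to `0`. -/
theorem eventually_lt_pruferAngle {q : ℝ → ℝ} (hq : IntervalIntegrable q volume 0 1)
    (θ₀ T : ℝ) : ∀ᶠ μ in atTop, ∀ θ : ℝ → ℝ, θ 0 = θ₀ → IsPruferAngle (fun x => q x - μ) θ →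
      T < θ 1 := by
  set M := ∫ s in (0 : ℝ)..1, |q s|
  have h1 : ∀ᶠ μ : ℝ in atTop, ∫ y in θ₀..T, (Real.cos y ^ 2 + μ * Real.sin y ^ 2)⁻¹ < 1 / 2 :=
    (tendsto_integral_inv_cos_sq_add θ₀ T).eventually_lt_const (by norm_num)
  filter_upwards [h1, eventually_ge_atTop 1, eventually_ge_atTop (2 * M)] with μ hμ1 hμ hμM
  intro θ h0 hθ
  by_contra! hT
  have hc := continuous_inv_cos_sq_add hμ
  have hΦ : ∀ y, HasDerivAt (fun y => ∫ s in θ₀..y, (Real.cos s ^ 2 + μ * Real.sin s ^ 2)⁻¹)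
      ((Real.cos y ^ 2 + μ * Real.sin y ^ 2)⁻¹) y := fun y =>
    intervalIntegral.integral_hasDerivAt_right (hc.intervalIntegrable _ _)
      (hc.stronglyMeasurableAtFilter _ _) hc.continuousAt
  have hcomp := HasACDeriv.comp hΦ hc hθ
  -- Along the angle, the primitive `Φ` of `1 / (cos² + μ sin²)` grows at rate at least `1 - |q| / μ`.
  have hlow := (hcomp.sub (HasACDeriv.of_integral (f := fun x => x - μ⁻¹ * ∫ s in (0 : ℝ)..x, |q s|)
      (g := fun x => 1 - μ⁻¹ * |q x|) (intervalIntegrable_const.sub (hq.abs.const_mul _))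
      (fun x hx => by
        rw [intervalIntegral.integral_sub intervalIntegrable_const
          ((hq.abs.mono_unit zero_mem_unit hx).const_mul _), intervalIntegral.integral_const_mul]
        simp))).le_of_nonneg (ae_of_all _ fun x _ => by
      have hD := one_le_cos_sq_add hμ (θ x)
      have hD0 : 0 < Real.cos (θ x) ^ 2 + μ * Real.sin (θ x) ^ 2 := by linarith
      rw [sub_nonneg, inv_mul_eq_div, inv_mul_eq_div, le_div_iff₀ hD0]
      have h2 : Real.sin (θ x) ^ 2 * μ ≤ Real.cos (θ x) ^ 2 + μ * Real.sin (θ x) ^ 2 := by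
        nlinarith [sq_nonneg (Real.cos (θ x))]
      have h3 : q x * Real.sin (θ x) ^ 2 ≤
          |q x| / μ * (Real.cos (θ x) ^ 2 + μ * Real.sin (θ x) ^ 2) := by
        rw [div_mul_eq_mul_div, le_div_iff₀ (by linarith)]
        calc q x * Real.sin (θ x) ^ 2 * μ ≤ |q x| * (Real.sin (θ x) ^ 2 * μ) := by
              rw [mul_assoc]; gcongr; exact le_abs_self _
          _ ≤ _ := by gcongr
      have h4 := Real.sin_sq_add_cos_sq (θ x)
      nlinarith) zero_mem_unit one_mem_unit zero_le_one
  simp only [intervalIntegral.integral_same, mul_zero, sub_zero, h0] at hlow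
  have h5 : μ⁻¹ * M ≤ 1 / 2 := by
    rw [inv_mul_eq_div, div_le_iff₀ (by linarith)]; linarith
  have h6 : ∫ s in θ₀..θ 1, (Real.cos s ^ 2 + μ * Real.sin s ^ 2)⁻¹ ≤
      ∫ s in θ₀..T, (Real.cos s ^ 2 + μ * Real.sin s ^ 2)⁻¹ := by
    have := intervalIntegral.integral_add_adjacent_intervals (hc.intervalIntegrable θ₀ (θ 1))
      (hc.intervalIntegrable (θ 1) T) (μ := volume)
    have : 0 ≤ ∫ s in θ 1..T, (Real.cos s ^ 2 + μ * Real.sin s ^ 2)⁻¹ :=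
      intervalIntegral.integral_nonneg hT fun s _ =>
        inv_nonneg.2 (zero_le_one.trans (one_le_cos_sq_add hμ s))
    linarith
  linarith

/-! ### Solutions of the linear equation -/

/-- `u` solves `u'' = p u` on `[0,1]`, and `v = u'`. -/
structure IsSol (p u v : ℝ → ℝ) : Prop where
  fst : HasACDeriv u v
  snd : HasACDeriv v fun x => p x * u x

namespace IsSol

variable {p p₁ p₂ u v u₁ v₁ u₂ v₂ : ℝ → ℝ}

/-- Lagrange's identity. -/
theorem wronskian (h₁ : IsSol p₁ u₁ v₁) (h₂ : IsSol p₂ u₂ v₂) :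
    HasACDeriv (fun x => u₁ x * v₂ x - v₁ x * u₂ x) fun x => (p₂ x - p₁ x) * (u₁ x * u₂ x) :=
  ((h₁.fst.mul h₂.snd).sub (h₁.snd.mul h₂.fst)).congr' fun x => by ring

theorem wronskian_eq (h₁ : IsSol p u₁ v₁) (h₂ : IsSol p u₂ v₂) {x y : ℝ}
    (hx : x ∈ Icc (0 : ℝ) 1) (hy : y ∈ Icc (0 : ℝ) 1) :
    u₁ x * v₂ x - v₁ x * u₂ x = u₁ y * v₂ y - v₁ y * u₂ y :=
  ((h₁.wronskian h₂).congr' (g' := fun _ => 0) fun x => by ring).eq_of_zero hx hy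

theorem lin_comb (h₁ : IsSol p u₁ v₁) (h₂ : IsSol p u₂ v₂) (c d : ℝ) :
    IsSol p (fun x => c * u₁ x + d * u₂ x) (fun x => c * v₁ x + d * v₂ x) :=
  ⟨(h₁.fst.const_mul c).add (h₂.fst.const_mul d),
    ((h₁.snd.const_mul c).add (h₂.snd.const_mul d)).congr' fun x => by ring⟩

end IsSol

/-- The Prüfer angle of `u'' = p u` with value `θ₀` at `0` (constant if `p` is not integrable). -/
noncomputable def prufer (θ₀ : ℝ) (p : ℝ → ℝ) : ℝ → ℝ :=
  open Classical in
  if hp : IntervalIntegrable p volume 0 1 then (exists_isPruferAngle hp θ₀).choose else fun _ => θ₀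

/-- The logarithm of the Prüfer amplitude of the solution with Prüfer angle `θ`. -/
noncomputable def logAmp (p θ : ℝ → ℝ) (x : ℝ) : ℝ :=
  ∫ s in (0 : ℝ)..x, (1 + p s) * (Real.sin (θ s) * Real.cos (θ s))

/-- The solution of `u'' = p u` with `(u, u') = (sin θ₀, cos θ₀)` at `0`. -/
noncomputable def solU (θ₀ : ℝ) (p : ℝ → ℝ) (x : ℝ) : ℝ :=
  Real.exp (logAmp p (prufer θ₀ p) x) * Real.sin (prufer θ₀ p x)

/-- The derivative of `solU θ₀ p`. -/
noncomputable def solV (θ₀ : ℝ) (p : ℝ → ℝ) (x : ℝ) : ℝ :=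
  Real.exp (logAmp p (prufer θ₀ p) x) * Real.cos (prufer θ₀ p x)

section

variable {p p₁ p₂ : ℝ → ℝ} (θ₀ : ℝ)

theorem prufer_zero (p : ℝ → ℝ) : prufer θ₀ p 0 = θ₀ := by
  unfold prufer
  split_ifs with hp
  · exact (exists_isPruferAngle hp θ₀).choose_spec.1
  · rfl

theorem isPruferAngle_prufer (hp : IntervalIntegrable p volume 0 1) :
    IsPruferAngle p (prufer θ₀ p) := by
  unfold prufer
  rw [dif_pos hp]
  exact (exists_isPruferAngle hp θ₀).choose_spec.2

theorem hasACDeriv_logAmp (hp : IntervalIntegrable p volume 0 1) {θ : ℝ → ℝ}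
    (hθ : ContinuousOn θ (Icc 0 1)) :
    HasACDeriv (logAmp p θ) fun x => (1 + p x) * (Real.sin (θ x) * Real.cos (θ x)) :=
  HasACDeriv.integral ((intervalIntegrable_one_add hp).mul_contOn
    ((Real.continuous_sin.comp_continuousOn hθ).mul (Real.continuous_cos.comp_continuousOn hθ)))

theorem isSol_sol (hp : IntervalIntegrable p volume 0 1) : IsSol p (solU θ₀ p) (solV θ₀ p) := by
  have hθ := isPruferAngle_prufer θ₀ hp
  have hr := (hasACDeriv_logAmp hp hθ.continuousOn).exp
  refine ⟨(hr.mul (HasACDeriv.sin hθ)).congr' fun x => ?_,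
    (hr.mul (HasACDeriv.cos hθ)).congr' fun x => ?_⟩
  · simp only [solV]; ring
  · have := Real.sin_sq_add_cos_sq (prufer θ₀ p x)
    simp only [solU]
    linear_combination (-(Real.exp (logAmp p (prufer θ₀ p) x) * Real.sin (prufer θ₀ p x) *
      (- (1 + p x)))) * this

theorem solU_zero (p : ℝ → ℝ) : solU θ₀ p 0 = Real.sin θ₀ := by
  simp [solU, logAmp, prufer_zero]

theorem solV_zero (p : ℝ → ℝ) : solV θ₀ p 0 = Real.cos θ₀ := by
  simp [solV, logAmp, prufer_zero]

theorem continuousOn_solU (hp : IntervalIntegrable p volume 0 1) :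
    ContinuousOn (solU θ₀ p) (Icc 0 1) := (isSol_sol θ₀ hp).fst.continuousOn

theorem solU_mul_cos_add (p : ℝ → ℝ) (b x : ℝ) :
    solU θ₀ p x * Real.cos b + solV θ₀ p x * Real.sin b =
      Real.exp (logAmp p (prufer θ₀ p) x) * Real.sin (prufer θ₀ p x + b) := by
  rw [solU, solV, Real.sin_add]; ring

theorem exists_solU_ne_zero (hp : IntervalIntegrable p volume 0 1) :
    ∃ x ∈ Icc (0 : ℝ) 1, solU θ₀ p x ≠ 0 := by
  obtain ⟨x, hx, h⟩ := (isPruferAngle_prufer θ₀ hp).exists_sin_ne_zero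
  exact ⟨x, hx, mul_ne_zero (Real.exp_pos _).ne' h⟩

theorem integral_solU_sq_pos (hp : IntervalIntegrable p volume 0 1) :
    0 < ∫ x in (0 : ℝ)..1, solU θ₀ p x ^ 2 := by
  obtain ⟨x, hx, h⟩ := exists_solU_ne_zero θ₀ hp
  exact intervalIntegral.integral_pos one_pos ((continuousOn_solU θ₀ hp).pow 2)
    (fun x _ => sq_nonneg _) ⟨x, hx, by positivity⟩

/-- A solution with vanishing Cauchy data at some point is zero. -/
theorem IsSol.eq_zero {u v : ℝ → ℝ} (h : IsSol p u v) (hp : IntervalIntegrable p volume 0 1)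
    {y : ℝ} (hy : y ∈ Icc (0 : ℝ) 1) (hu : u y = 0) (hv : v y = 0) {x : ℝ}
    (hx : x ∈ Icc (0 : ℝ) 1) : u x = 0 := by
  have h1 := isSol_sol 0 hp
  have h2 := isSol_sol (Real.pi / 2) hp
  have e1 := h.wronskian_eq h1 hx hy
  have e2 := h.wronskian_eq h2 hx hy
  have e3 := h1.wronskian_eq h2 hx zero_mem_unit
  simp only [hu, hv, solU_zero, solV_zero, Real.sin_zero, Real.cos_zero, Real.sin_pi_div_two,
    Real.cos_pi_div_two] at e1 e2 e3
  -- Cramer's rule: both Wronskians with a fundamental system vanish.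
  linear_combination solU (Real.pi / 2) p x * e1 - solU 0 p x * e2 + u x * e3

/-- How far the solution can move when the potential moves by `ε` in `L¹`; `N` is the norm of
`1 + p`. -/
noncomputable def solModulus (N ε : ℝ) : ℝ :=
  Real.exp N * (Real.exp ((1 + N * Real.exp (2 * N)) * ε) - 1 + Real.exp (2 * N) * ε)

theorem tendsto_solModulus (N : ℝ) : Tendsto (solModulus N) (𝓝 0) (𝓝 0) := by
  have h : Continuous (solModulus N) := by unfold solModulus; fun_prop
  simpa [solModulus] using h.tendsto 0

theorem abs_sin_mul_cos_sub_le (a b : ℝ) :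
    |Real.sin a * Real.cos a - Real.sin b * Real.cos b| ≤ |a - b| := by
  have h : ∀ y : ℝ, Real.sin y * Real.cos y = Real.sin (2 * y) / 2 := fun y => by
    rw [Real.sin_two_mul]; ring
  have := Real.abs_sin_sub_sin_le (2 * a) (2 * b)
  rw [← mul_sub, abs_mul, abs_two] at this
  rw [h, h, ← sub_div, abs_div, abs_two]
  linarith

theorem abs_prufer_sub_le (hp₁ : IntervalIntegrable p₁ volume 0 1)
    (hp₂ : IntervalIntegrable p₂ volume 0 1) {x : ℝ} (hx : x ∈ Icc (0 : ℝ) 1) :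
    |prufer θ₀ p₁ x - prufer θ₀ p₂ x| ≤ Real.exp (2 * ∫ s in (0 : ℝ)..1, |1 + p₂ s|) *
      ∫ s in (0 : ℝ)..1, |p₁ s - p₂ s| := by
  rw [abs_sub_comm]
  exact (isPruferAngle_prufer θ₀ hp₁).abs_sub_le hp₁ hp₂ (isPruferAngle_prufer θ₀ hp₂)
    (by rw [prufer_zero, prufer_zero]) hx

theorem abs_solU_sub_le (hp₁ : IntervalIntegrable p₁ volume 0 1)
    (hp₂ : IntervalIntegrable p₂ volume 0 1) {x : ℝ} (hx : x ∈ Icc (0 : ℝ) 1) :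
    |solU θ₀ p₁ x - solU θ₀ p₂ x| ≤
      solModulus (∫ s in (0 : ℝ)..1, |1 + p₂ s|) (∫ s in (0 : ℝ)..1, |p₁ s - p₂ s|) := by
  have hθ := fun s (hs : s ∈ Icc (0 : ℝ) 1) => abs_prufer_sub_le θ₀ hp₁ hp₂ hs
  set N := ∫ s in (0 : ℝ)..1, |1 + p₂ s| with hN
  set ε := ∫ s in (0 : ℝ)..1, |p₁ s - p₂ s| with hε
  set θ₁ := prufer θ₀ p₁
  set θ₂ := prufer θ₀ p₂
  have hc₁ := (isPruferAngle_prufer θ₀ hp₁).continuousOn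
  have hc₂ := (isPruferAngle_prufer θ₀ hp₂).continuousOn
  have hI1 := hasACDeriv_logAmp hp₁ hc₁
  have hI2 := hasACDeriv_logAmp hp₂ hc₂
  have hamp : |logAmp p₁ θ₁ x - logAmp p₂ θ₂ x| ≤ (1 + N * Real.exp (2 * N)) * ε := by
    rw [logAmp, logAmp, ← intervalIntegral.integral_sub
      (hI1.intervalIntegrable.mono_unit zero_mem_unit hx)
      (hI2.intervalIntegrable.mono_unit zero_mem_unit hx)]
    refine (abs_integral_le_unit (g := fun s => |p₁ s - p₂ s| +
      |1 + p₂ s| * (Real.exp (2 * N) * ε)) ((hp₁.sub hp₂).abs.add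
        ((intervalIntegrable_one_add hp₂).abs.mul_const _)) (fun s hs => ?_) hx).trans (le_of_eq ?_)
    · have e : (1 + p₁ s) * (Real.sin (θ₁ s) * Real.cos (θ₁ s)) -
          (1 + p₂ s) * (Real.sin (θ₂ s) * Real.cos (θ₂ s)) =
          (p₁ s - p₂ s) * (Real.sin (θ₁ s) * Real.cos (θ₁ s)) + (1 + p₂ s) *
          (Real.sin (θ₁ s) * Real.cos (θ₁ s) - Real.sin (θ₂ s) * Real.cos (θ₂ s)) := by ring
      rw [e]
      refine (abs_add_le _ _).trans (add_le_add ?_ ?_)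
      · rw [abs_mul, abs_mul]
        exact mul_le_of_le_one_right (abs_nonneg _)
          (mul_le_one₀ (Real.abs_sin_le_one _) (abs_nonneg _) (Real.abs_cos_le_one _))
      · rw [abs_mul]
        gcongr
        exact (abs_sin_mul_cos_sub_le _ _).trans (hθ s hs)
    · rw [intervalIntegral.integral_add (hp₁.sub hp₂).abs
        ((intervalIntegrable_one_add hp₂).abs.mul_const _), intervalIntegral.integral_mul_const]
      rw [← hN, ← hε]; ring
  have hamp2 : logAmp p₂ θ₂ x ≤ N := by
    refine (le_abs_self _).trans (abs_integral_le_unit (intervalIntegrable_one_add hp₂).abs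
      (fun s _ => ?_) hx)
    rw [abs_mul, abs_mul]
    exact mul_le_of_le_one_right (abs_nonneg _)
      (mul_le_one₀ (Real.abs_sin_le_one _) (abs_nonneg _) (Real.abs_cos_le_one _))
  have hexp : |Real.exp (logAmp p₁ θ₁ x) - Real.exp (logAmp p₂ θ₂ x)| ≤
      Real.exp N * (Real.exp ((1 + N * Real.exp (2 * N)) * ε) - 1) := by
    set d := logAmp p₁ θ₁ x - logAmp p₂ θ₂ x with hd
    have e : logAmp p₁ θ₁ x = logAmp p₂ θ₂ x + d := by rw [hd]; ring
    rw [e, Real.exp_add, ← mul_sub_one, abs_mul, abs_of_pos (Real.exp_pos _)]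
    refine mul_le_mul (Real.exp_le_exp.2 hamp2) ?_ (abs_nonneg _) (Real.exp_pos _).le
    have h1 : Real.exp d ≤ Real.exp ((1 + N * Real.exp (2 * N)) * ε) :=
      Real.exp_le_exp.2 ((le_abs_self _).trans hamp)
    have h2 : Real.exp (-d) ≤ Real.exp ((1 + N * Real.exp (2 * N)) * ε) :=
      Real.exp_le_exp.2 ((neg_le_abs _).trans hamp)
    rw [abs_le]
    refine ⟨?_, by linarith⟩
    have h3 := Real.add_one_le_exp d
    have h4 := Real.add_one_le_exp (-d)
    linarith
  have e : solU θ₀ p₁ x - solU θ₀ p₂ x = (Real.exp (logAmp p₁ θ₁ x) - Real.exp (logAmp p₂ θ₂ x)) *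
      Real.sin (θ₁ x) + Real.exp (logAmp p₂ θ₂ x) * (Real.sin (θ₁ x) - Real.sin (θ₂ x)) := by
    simp only [solU]; ring
  rw [e, solModulus, mul_add]
  refine (abs_add_le _ _).trans (add_le_add ?_ ?_)
  · rw [abs_mul]
    exact (mul_le_of_le_one_right (abs_nonneg _) (Real.abs_sin_le_one _)).trans hexp
  · rw [abs_mul, abs_of_pos (Real.exp_pos _)]
    exact mul_le_mul (Real.exp_le_exp.2 hamp2)
      ((Real.abs_sin_sub_sin_le _ _).trans (hθ x hx)) (abs_nonneg _) (Real.exp_pos _).le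

end

/-! ### Energy estimates for eigenfunctions -/

/-- A constant that controls `|u u'|` by `u²` where `u cos a + u' sin a = 0`; for `sin a = 0` it is
`0`, which is right since then `u = 0`. -/
noncomputable def bcBound (a : ℝ) : ℝ := |Real.cos a / Real.sin a|

theorem abs_mul_le_bcBound {a x y : ℝ} (h : x * Real.cos a + y * Real.sin a = 0) :
    |x * y| ≤ bcBound a * x ^ 2 := by
  by_cases hs : Real.sin a = 0
  · have hc : Real.cos a ≠ 0 := fun hc => by
      have := Real.sin_sq_add_cos_sq a
      rw [hs, hc] at this; norm_num at this
    have hx : x = 0 := by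
      rw [hs, mul_zero, add_zero] at h
      exact (mul_eq_zero.1 h).resolve_right hc
    simp [hx]
  · have hy : y = -(Real.cos a / Real.sin a) * x := by field_simp; linarith
    rw [bcBound, hy, ← abs_of_nonneg (sq_nonneg x), ← abs_mul]
    refine le_of_eq ?_
    rw [show x * (-(Real.cos a / Real.sin a) * x) = -(Real.cos a / Real.sin a * x ^ 2) by ring,
      abs_neg]

/-- Two functions satisfying the same separated boundary condition have vanishing Wronskian
there. -/
theorem bc_wronskian_eq_zero {b u v w z : ℝ} (h₁ : u * Real.cos b + v * Real.sin b = 0)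
    (h₂ : w * Real.cos b + z * Real.sin b = 0) : u * z - v * w = 0 := by
  have hcs := Real.sin_sq_add_cos_sq b
  linear_combination (-(u * z - v * w)) * hcs + (u * Real.sin b - v * Real.cos b) * h₂ +
    (z * Real.cos b - w * Real.sin b) * h₁

theorem integral_mono_unit {f g : ℝ → ℝ} (hf : IntervalIntegrable f volume 0 1)
    (hg : IntervalIntegrable g volume 0 1) (h : ∀ x ∈ Icc (0 : ℝ) 1, f x ≤ g x) :
    ∫ x in (0 : ℝ)..1, f x ≤ ∫ x in (0 : ℝ)..1, g x :=
  intervalIntegral.integral_mono_on zero_le_one hf hg h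

theorem integral_sq_nonneg (f : ℝ → ℝ) : 0 ≤ ∫ s in (0 : ℝ)..1, f s ^ 2 :=
  intervalIntegral.integral_nonneg zero_le_one fun _ _ => sq_nonneg _

namespace IsSol

variable {p q u v : ℝ → ℝ} {a b μ M : ℝ}

theorem continuousOn_fst (h : IsSol p u v) : ContinuousOn u (Icc 0 1) := h.fst.continuousOn

theorem continuousOn_snd (h : IsSol p u v) : ContinuousOn v (Icc 0 1) := h.snd.continuousOn

theorem intervalIntegrable_sq_fst (h : IsSol p u v) :
    IntervalIntegrable (fun s => u s ^ 2) volume 0 1 :=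
  (h.continuousOn_fst.pow 2).intervalIntegrable_unit

theorem intervalIntegrable_sq_snd (h : IsSol p u v) :
    IntervalIntegrable (fun s => v s ^ 2) volume 0 1 :=
  (h.continuousOn_snd.pow 2).intervalIntegrable_unit

/-- A Sobolev inequality with a small constant in front of the norm of the derivative. -/
theorem sq_le_integral (h : IsSol p u v) {ε : ℝ} (hε : 0 < ε) {x : ℝ} (hx : x ∈ Icc (0 : ℝ) 1) :
    u x ^ 2 ≤ (1 + ε⁻¹) * (∫ s in (0 : ℝ)..1, u s ^ 2) + ε * ∫ s in (0 : ℝ)..1, v s ^ 2 := by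
  have hu2 := h.intervalIntegrable_sq_fst
  have hv2 := h.intervalIntegrable_sq_snd
  have hg : IntervalIntegrable (fun s => ε⁻¹ * u s ^ 2 + ε * v s ^ 2) volume 0 1 :=
    (hu2.const_mul _).add (hv2.const_mul _)
  have hw := HasACDeriv.integral hg
  set w : ℝ → ℝ := fun x => ∫ s in (0 : ℝ)..x, (ε⁻¹ * u s ^ 2 + ε * v s ^ 2) with hwdef
  have hw0 : w 0 = 0 := by simp [hwdef]
  have hg0 : ∀ s, 0 ≤ ε⁻¹ * u s ^ 2 + ε * v s ^ 2 := fun s => by positivity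
  have hwm : ∀ {s t : ℝ}, s ∈ Icc (0 : ℝ) 1 → t ∈ Icc (0 : ℝ) 1 → s ≤ t → w s ≤ w t :=
    fun hs ht hst => hw.le_of_nonneg (ae_of_all _ fun x _ => hg0 x) hs ht hst
  have hamgm : ∀ s, 0 ≤ ε⁻¹ * u s ^ 2 + ε * v s ^ 2 + 2 * (u s * v s) ∧
      0 ≤ ε⁻¹ * u s ^ 2 + ε * v s ^ 2 - 2 * (u s * v s) := fun s => by
    have e1 : ε⁻¹ * (u s + ε * v s) ^ 2 = ε⁻¹ * u s ^ 2 + ε * v s ^ 2 + 2 * (u s * v s) := by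
      field_simp; ring
    have e2 : ε⁻¹ * (u s - ε * v s) ^ 2 = ε⁻¹ * u s ^ 2 + ε * v s ^ 2 - 2 * (u s * v s) := by
      field_simp; ring
    rw [← e1, ← e2]; constructor <;> positivity
  -- `w ± u²` are increasing since `|2 u u'| ≤ u² / ε + ε u'²`.
  have key : ∀ y ∈ Icc (0 : ℝ) 1, u x ^ 2 ≤ u y ^ 2 + w 1 := by
    intro y hy
    rcases le_total y x with hyx | hyx
    · have h1 := (hw.sub (h.fst.mul h.fst)).le_of_nonneg (ae_of_all _ fun s _ => by
        linarith [(hamgm s).2]) hy hx hyx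
      have h2 := hwm hx one_mem_unit hx.2
      have h3 := hwm zero_mem_unit hy hy.1
      nlinarith
    · have h1 := (hw.add (h.fst.mul h.fst)).le_of_nonneg (ae_of_all _ fun s _ => by
        linarith [(hamgm s).1]) hx hy hyx
      have h2 := hwm hy one_mem_unit hy.2
      have h3 := hwm zero_mem_unit hx hx.1
      nlinarith
  have h4 := integral_mono_unit intervalIntegrable_const (hu2.add intervalIntegrable_const) key
  rw [intervalIntegral.integral_add hu2 intervalIntegrable_const] at h4
  simp only [intervalIntegral.integral_const, sub_zero, one_smul] at h4
  have h5 : w 1 = ε⁻¹ * (∫ s in (0 : ℝ)..1, u s ^ 2) + ε * ∫ s in (0 : ℝ)..1, v s ^ 2 := by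
    simp only [hwdef]
    rw [intervalIntegral.integral_add (hu2.const_mul _) (hv2.const_mul _),
      intervalIntegral.integral_const_mul, intervalIntegral.integral_const_mul]
  linarith

/-- The energy identity, as an upper bound for `∫ u'²`. -/
theorem integral_sq_snd_le (hq : IntervalIntegrable q volume 0 1) (hM : ∫ s in (0 : ℝ)..1, |q s| ≤ M)
    (h : IsSol (fun x => q x - μ) u v) (h0 : u 0 * Real.cos a + v 0 * Real.sin a = 0)
    (h1 : u 1 * Real.cos b + v 1 * Real.sin b = 0) {S : ℝ}
    (hS : ∀ x ∈ Icc (0 : ℝ) 1, u x ^ 2 ≤ S) :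
    ∫ s in (0 : ℝ)..1, v s ^ 2 ≤
      μ * (∫ s in (0 : ℝ)..1, u s ^ 2) + (M + bcBound a + bcBound b) * S := by
  have hu2 := h.intervalIntegrable_sq_fst
  have hv2 := h.intervalIntegrable_sq_snd
  have hS0 : 0 ≤ S := (sq_nonneg _).trans (hS 0 zero_mem_unit)
  have hqu : IntervalIntegrable (fun s => q s * u s ^ 2) volume 0 1 :=
    hq.mul_contOn (h.continuousOn_fst.pow 2)
  have e := (h.fst.mul h.snd).integral_eq zero_mem_unit one_mem_unit
  have e2 : ∫ x in (0 : ℝ)..1, (v x * v x + u x * ((q x - μ) * u x)) =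
      (∫ s in (0 : ℝ)..1, v s ^ 2) + (∫ s in (0 : ℝ)..1, q s * u s ^ 2) -
        μ * ∫ s in (0 : ℝ)..1, u s ^ 2 := by
    rw [← intervalIntegral.integral_const_mul, ← intervalIntegral.integral_add hv2 hqu,
      ← intervalIntegral.integral_sub (hv2.add hqu) (hu2.const_mul _)]
    congr 1; ext x; ring
  rw [e2] at e
  have h3 : |∫ s in (0 : ℝ)..1, q s * u s ^ 2| ≤ M * S := by
    refine (abs_integral_le_unit (hq.abs.mul_const S) (fun s hs => ?_) one_mem_unit).trans ?_
    · rw [abs_mul, abs_of_nonneg (sq_nonneg (u s))]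
      gcongr; exact hS s hs
    · rw [intervalIntegral.integral_mul_const]; gcongr
  have h4 := abs_mul_le_bcBound h0
  have h5 := abs_mul_le_bcBound h1
  have h6 : bcBound a * u 0 ^ 2 ≤ bcBound a * S :=
    mul_le_mul_of_nonneg_left (hS 0 zero_mem_unit) (abs_nonneg _)
  have h7 : bcBound b * u 1 ^ 2 ≤ bcBound b * S :=
    mul_le_mul_of_nonneg_left (hS 1 one_mem_unit) (abs_nonneg _)
  have := (abs_le.1 h3).1
  have := (abs_le.1 h4).1
  have := (abs_le.1 h5).2
  linarith

end IsSol

/-- `-lowerBound a b M` is a lower bound for the eigenvalues of all potentials whose norm in `L¹`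
is at most `M`. -/
noncomputable def lowerBound (a b M : ℝ) : ℝ :=
  (M + bcBound a + bcBound b) * (2 * (M + bcBound a + bcBound b) + 3)

theorem lowerBound_mono {a b M M' : ℝ} (hM : 0 ≤ M) (h : M ≤ M') :
    lowerBound a b M ≤ lowerBound a b M' := by
  have ha : 0 ≤ bcBound a := abs_nonneg _
  have hb : 0 ≤ bcBound b := abs_nonneg _
  have hM' := hM.trans h
  unfold lowerBound
  gcongr

/-- The ratio of `max u²` and `∫ u²` for eigenfunctions `u` of potentials whose norm in `L¹` is at
most `M` is at most `supBound a b M`. -/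
noncomputable def supBound (a b M : ℝ) : ℝ :=
  4 * Real.exp M + (2 * (M + bcBound a + bcBound b) + 3) + lowerBound a b M +
    (1 + 2 * Real.exp M * (M + bcBound a + bcBound b))

namespace IsSol

variable {p q u v : ℝ → ℝ} {a b μ M : ℝ}

/-- The energy identity combined with the Sobolev inequality, with the constant `ε` chosen such
that half of `∫ u'²` is absorbed on the left. -/
theorem integral_sq_snd_le' (hq : IntervalIntegrable q volume 0 1)
    (hM : ∫ s in (0 : ℝ)..1, |q s| ≤ M)
    (h : IsSol (fun x => q x - μ) u v) (h0 : u 0 * Real.cos a + v 0 * Real.sin a = 0)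
    (h1 : u 1 * Real.cos b + v 1 * Real.sin b = 0) :
    ∫ s in (0 : ℝ)..1, v s ^ 2 ≤ 2 * (μ + lowerBound a b M) * ∫ s in (0 : ℝ)..1, u s ^ 2 := by
  have hM0 : 0 ≤ M := le_trans
    (intervalIntegral.integral_nonneg zero_le_one fun s _ => abs_nonneg (q s)) hM
  have ha : 0 ≤ bcBound a := abs_nonneg _
  have hb : 0 ≤ bcBound b := abs_nonneg _
  set K := M + bcBound a + bcBound b with hK
  have hK0 : 0 ≤ K := by positivity
  have hε : 0 < (2 * (K + 1))⁻¹ := by positivity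
  have h2 := integral_sq_snd_le hq hM h h0 h1 (fun x hx => h.sq_le_integral hε hx)
  rw [inv_inv, ← hK] at h2
  have hD := integral_sq_nonneg v
  have h3 : K * (2 * (K + 1))⁻¹ ≤ 1 / 2 := by
    rw [← div_eq_mul_inv, div_le_iff₀ (by positivity)]; linarith
  have h4 := mul_le_mul_of_nonneg_right h3 hD
  rw [lowerBound, ← hK]
  nlinarith

theorem neg_lowerBound_le (hq : IntervalIntegrable q volume 0 1)
    (hM : ∫ s in (0 : ℝ)..1, |q s| ≤ M)
    (h : IsSol (fun x => q x - μ) u v) (h0 : u 0 * Real.cos a + v 0 * Real.sin a = 0)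
    (h1 : u 1 * Real.cos b + v 1 * Real.sin b = 0) (hN : 0 < ∫ s in (0 : ℝ)..1, u s ^ 2) :
    -lowerBound a b M ≤ μ := by
  have h2 := (integral_sq_nonneg v).trans (integral_sq_snd_le' hq hM h h0 h1)
  have := nonneg_of_mul_nonneg_left h2 hN
  linarith

/-- Eigenfunctions are bounded uniformly relative to their norm in `L²`. For small `μ` this is the
Sobolev inequality; for large `μ` the energy `μ u² + u'²` is nearly constant. -/
theorem sq_le_supBound (hq : IntervalIntegrable q volume 0 1)
    (hM : ∫ s in (0 : ℝ)..1, |q s| ≤ M)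
    (h : IsSol (fun x => q x - μ) u v) (h0 : u 0 * Real.cos a + v 0 * Real.sin a = 0)
    (h1 : u 1 * Real.cos b + v 1 * Real.sin b = 0) {x : ℝ} (hx : x ∈ Icc (0 : ℝ) 1) :
    u x ^ 2 ≤ supBound a b M * ∫ s in (0 : ℝ)..1, u s ^ 2 := by
  have hM0 : 0 ≤ M := le_trans
    (intervalIntegral.integral_nonneg zero_le_one fun s _ => abs_nonneg (q s)) hM
  have ha : 0 ≤ bcBound a := abs_nonneg _
  have hb : 0 ≤ bcBound b := abs_nonneg _
  have hN := integral_sq_nonneg u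
  have hD := integral_sq_nonneg v
  have hu2 := h.intervalIntegrable_sq_fst
  have hv2 := h.intervalIntegrable_sq_snd
  have hL : 0 ≤ lowerBound a b M := by unfold lowerBound; positivity
  have hexp : 1 ≤ Real.exp M := Real.one_le_exp hM0
  rw [supBound]
  set K := M + bcBound a + bcBound b with hK
  set N := ∫ s in (0 : ℝ)..1, u s ^ 2
  set D := ∫ s in (0 : ℝ)..1, v s ^ 2
  have hK0 : 0 ≤ K := by positivity
  have hL1 : 0 ≤ 4 * Real.exp M * N := by positivity
  have hL2 : 0 ≤ (2 * K + 3) * N := by positivity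
  have hL3 : 0 ≤ lowerBound a b M * N := by positivity
  have hL4 : 0 ≤ (1 + 2 * Real.exp M * K) * N := by positivity
  rcases le_total μ (1 + 2 * Real.exp M * K) with hμ | hμ
  · have hε : 0 < (2 * (K + 1))⁻¹ := by positivity
    have h2 := h.sq_le_integral hε hx
    have h3 := integral_sq_snd_le' hq hM h h0 h1
    rw [inv_inv] at h2
    have h4 : (2 * (K + 1))⁻¹ * D ≤ (μ + lowerBound a b M) * N := by
      have h5 : (2 * (K + 1))⁻¹ ≤ 2⁻¹ := by gcongr; linarith
      calc _ ≤ 2⁻¹ * D := by gcongr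
        _ ≤ _ := by linarith
    have h6 : μ * N ≤ (1 + 2 * Real.exp M * K) * N := by gcongr
    nlinarith
  · have hμ1 : 1 ≤ μ := by
      have : 0 ≤ 2 * Real.exp M * K := by positivity
      linarith
    have hE := ((h.fst.mul h.fst).const_mul μ).add (h.snd.mul h.snd)
    have hgr : ∀ {s t : ℝ}, s ∈ Icc (0 : ℝ) 1 → t ∈ Icc (0 : ℝ) 1 →
        μ * (u s * u s) + v s * v s ≤ Real.exp M * (μ * (u t * u t) + v t * v t) := by
      intro s t hs ht
      refine (hE.gronwall hq.abs (fun x => abs_nonneg _) (fun x _ => ?_)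
        (ae_of_all _ fun x _ => ?_) hs ht).trans ?_
      · have := mul_self_nonneg (u x); have := mul_self_nonneg (v x); positivity
      · have e : μ * (v x * u x + u x * v x) +
            ((q x - μ) * u x * v x + v x * ((q x - μ) * u x)) = q x * (2 * (u x * v x)) := by ring
        rw [e, abs_mul]
        gcongr
        have := mul_self_nonneg (u x)
        rw [abs_le]; constructor <;> nlinarith [sq_nonneg (u x + v x), sq_nonneg (u x - v x)]
      · have := mul_self_nonneg (u t); have := mul_self_nonneg (v t)
        gcongr
    obtain ⟨x₀, hx₀, hmax⟩ := isCompact_Icc.exists_isMaxOn ⟨0, zero_mem_unit⟩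
      (h.continuousOn_fst.pow 2)
    have hS : ∀ y ∈ Icc (0 : ℝ) 1, u y ^ 2 ≤ u x₀ ^ 2 := fun y hy => hmax hy
    have hDle := integral_sq_snd_le hq hM h h0 h1 hS
    rw [← hK] at hDle
    change D ≤ μ * N + K * u x₀ ^ 2 at hDle
    have h2 := integral_mono_unit intervalIntegrable_const
      (((hu2.const_mul μ).add hv2).const_mul (Real.exp M)) (fun t ht => by
        have := hgr hx₀ ht
        simpa only [sq] using this)
    simp only [intervalIntegral.integral_const, sub_zero, one_smul] at h2
    rw [intervalIntegral.integral_const_mul, intervalIntegral.integral_add (hu2.const_mul μ) hv2,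
      intervalIntegral.integral_const_mul] at h2
    have h3 : μ * u x₀ ^ 2 ≤ Real.exp M * (2 * μ * N + K * u x₀ ^ 2) := by
      have h4 : Real.exp M * (μ * N + D) ≤ Real.exp M * (2 * μ * N + K * u x₀ ^ 2) :=
        mul_le_mul_of_nonneg_left (by linarith) (Real.exp_pos M).le
      have h5 := h2.trans h4
      have h6 := mul_self_nonneg (v x₀)
      rw [sq]
      linarith
    have h6 : 2 * (Real.exp M * K) * u x₀ ^ 2 ≤ μ * u x₀ ^ 2 := by gcongr; linarith
    have h7 : μ * u x₀ ^ 2 ≤ μ * (4 * Real.exp M * N) := by linarith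
    have h8 := le_of_mul_le_mul_left h7 (by linarith)
    have h9 := hS x hx
    nlinarith

end IsSol

/-! ### Counting eigenvalues with the Prüfer angle -/

/-- The Prüfer angle at the right endpoint of the solution of `-u'' + q u = μ u` that satisfies
the boundary condition with angle `a` at the left endpoint. -/
noncomputable def endAngle (a : ℝ) (q : ℝ → ℝ) (μ : ℝ) : ℝ := prufer (-a) (fun x => q x - μ) 1

section

variable {q : ℝ → ℝ} {a b μ M : ℝ}

theorem endAngle_strictMono (a : ℝ) (hq : IntervalIntegrable q volume 0 1) :
    StrictMono (endAngle a q) := fun μ ν h =>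
  (isPruferAngle_prufer (-a) (intervalIntegrable_sub_const hq μ)).lt_of_sub_const
    (c := ν - μ) (sub_pos.2 h) (intervalIntegrable_sub_const hq ν)
    (isPruferAngle_prufer (-a) (intervalIntegrable_sub_const hq ν))
    (by rw [prufer_zero, prufer_zero]) fun x => by ring

/-- The angle at the right endpoint depends continuously on parameters on which the potential
depends continuously in `L¹`. -/
theorem continuous_prufer_one {P : ℝ → ℝ → ℝ} (θ₀ : ℝ)
    (hP : ∀ s, IntervalIntegrable (P s) volume 0 1)
    (hlim : ∀ s₀, Tendsto (fun s => ∫ x in (0 : ℝ)..1, |P s x - P s₀ x|) (𝓝 s₀) (𝓝 0)) :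
    Continuous fun s => prufer θ₀ (P s) 1 := by
  refine continuous_iff_continuousAt.2 fun s₀ => ?_
  refine tendsto_iff_dist_tendsto_zero.2 ?_
  have h := (hlim s₀).const_mul (Real.exp (2 * ∫ s in (0 : ℝ)..1, |1 + P s₀ s|))
  rw [mul_zero] at h
  exact squeeze_zero (fun _ => dist_nonneg)
    (fun s => abs_prufer_sub_le θ₀ (hP s) (hP s₀) one_mem_unit) h

theorem endAngle_continuous (a : ℝ) (hq : IntervalIntegrable q volume 0 1) :
    Continuous (endAngle a q) := by
  refine continuous_prufer_one (P := fun μ x => q x - μ) (-a)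
    (fun μ => intervalIntegrable_sub_const hq μ) fun μ₀ => ?_
  have h : ∀ μ, ∫ x in (0 : ℝ)..1, |q x - μ - (q x - μ₀)| = |μ₀ - μ| := fun μ => by
    simp
  simp only [h]
  exact Continuous.tendsto' (by fun_prop) _ _ (by simp)

theorem sin_endAngle_add_ne_zero (hq : IntervalIntegrable q volume 0 1)
    (hM : ∫ s in (0 : ℝ)..1, |q s| ≤ M) (hμ : μ < -lowerBound a b M) :
    Real.sin (endAngle a q μ + b) ≠ 0 := by
  intro h
  have hp := intervalIntegrable_sub_const hq μ
  refine hμ.not_ge ((isSol_sol (-a) hp).neg_lowerBound_le hq hM (a := a) (b := b) ?_ ?_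
    (integral_solU_sq_pos (-a) hp))
  · rw [solU_mul_cos_add, prufer_zero]; simp
  · rw [solU_mul_cos_add]
    exact mul_eq_zero_of_right _ h

/-- A continuous function that avoids the multiples of `π` stays between two consecutive ones. -/
theorem floor_div_pi_eq {g : ℝ → ℝ} (hg : Continuous g) {c d : ℝ}
    (h : ∀ x ∈ uIcc c d, Real.sin (g x) ≠ 0) : ⌊g c / Real.pi⌋ = ⌊g d / Real.pi⌋ := by
  have hπ := Real.pi_pos
  have key : ∀ m : ℤ, (m : ℝ) * Real.pi ∉ uIcc (g c) (g d) := by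
    intro m hm
    obtain ⟨x, hx, hgx⟩ := intermediate_value_uIcc hg.continuousOn hm
    exact h x hx (by rw [hgx, Real.sin_int_mul_pi])
  refine Int.floor_eq_iff.2 ⟨?_, ?_⟩
  · by_contra! H
    rw [div_lt_iff₀ hπ] at H
    exact key _ (mem_uIcc.2 (Or.inl ⟨H.le, (le_div_iff₀ hπ).1 (Int.floor_le _)⟩))
  · by_contra! H
    rw [le_div_iff₀ hπ] at H
    have h2 := (div_lt_iff₀ hπ).1 (Int.lt_floor_add_one (g d / Real.pi))
    exact key (⌊g d / Real.pi⌋ + 1) (mem_uIcc.2 (Or.inr ⟨by push_cast; exact h2.le,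
      by push_cast; exact H⟩))

/-- The multiple of `π` that belongs to the lowest eigenvalue, read off at a spectral parameter
below all eigenvalues of the zero potential. -/
noncomputable def firstIndex (a b : ℝ) : ℤ :=
  ⌊(endAngle a (fun _ => 0) (-lowerBound a b 0 - 1) + b) / Real.pi⌋ + 1

/-- Below all eigenvalues the angle lies in a strip that does not depend on the potential, since
the potential can be deformed to zero without producing an eigenvalue. -/
theorem floor_endAngle_add_one (hq : IntervalIntegrable q volume 0 1)
    (hM : ∫ s in (0 : ℝ)..1, |q s| ≤ M) (hμ : μ < -lowerBound a b M) :
    ⌊(endAngle a q μ + b) / Real.pi⌋ + 1 = firstIndex a b := by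
  have hM0 : 0 ≤ M := le_trans
    (intervalIntegral.integral_nonneg zero_le_one fun s _ => abs_nonneg (q s)) hM
  have hz : IntervalIntegrable (fun _ => (0 : ℝ)) volume 0 1 := intervalIntegrable_const
  have hcont : Continuous fun s : ℝ => endAngle a (fun x => s * q x) μ + b := by
    refine Continuous.add ?_ continuous_const
    refine continuous_prufer_one (P := fun s x => s * q x - μ) (-a)
      (fun s => intervalIntegrable_sub_const (hq.const_mul s) μ) fun s₀ => ?_
    have h : ∀ s, ∫ x in (0 : ℝ)..1, |s * q x - μ - (s₀ * q x - μ)| =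
        |s - s₀| * ∫ x in (0 : ℝ)..1, |q x| := fun s => by
      rw [← intervalIntegral.integral_const_mul]
      congr 1; ext x; rw [← abs_mul]; congr 1; ring
    simp only [h]
    exact Continuous.tendsto' (by fun_prop) _ _ (by simp)
  -- Deform the potential to zero at the fixed parameter `μ`.
  have h1 := floor_div_pi_eq hcont (c := 1) (d := 0) (fun s hs => by
    rw [uIcc_of_ge zero_le_one] at hs
    refine sin_endAngle_add_ne_zero (hq.const_mul s) ?_ hμ
    have : ∀ x, |s * q x| = s * |q x| := fun x => by rw [abs_mul, abs_of_nonneg hs.1]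
    simp only [this, intervalIntegral.integral_const_mul]
    refine (mul_le_of_le_one_left ?_ hs.2).trans hM
    exact intervalIntegral.integral_nonneg zero_le_one fun s _ => abs_nonneg (q s))
  simp only [one_mul, zero_mul] at h1
  have hlow := lowerBound_mono (a := a) (b := b) le_rfl hM0
  -- Move the parameter for the zero potential to the one in the definition of `firstIndex`.
  have h2 := floor_div_pi_eq (g := fun μ => endAngle a (fun _ => 0) μ + b)
    ((endAngle_continuous a hz).add continuous_const) (c := μ) (d := -lowerBound a b 0 - 1)
    (fun ν hν => by
      refine sin_endAngle_add_ne_zero (M := 0) hz (by simp) ?_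
      rcases mem_uIcc.1 hν with h | h
      · linarith [h.2]
      · linarith [h.2])
  rw [firstIndex, ← h2, h1]

/-- The level `k` is attained by the angle if and only if `k ≥ firstIndex a b`. -/
theorem exists_endAngle_add_eq_iff (hq : IntervalIntegrable q volume 0 1) (k : ℤ) :
    (∃ μ, endAngle a q μ + b = k * Real.pi) ↔ firstIndex a b ≤ k := by
  have hπ := Real.pi_pos
  set M := ∫ s in (0 : ℝ)..1, |q s| with hM
  have hfl : ∀ {μ}, μ < -lowerBound a b M →
      ⌊(endAngle a q μ + b) / Real.pi⌋ + 1 = firstIndex a b :=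
    fun h => floor_endAngle_add_one hq hM.ge h
  constructor
  · rintro ⟨μ, hμ⟩
    obtain ⟨ν, hν⟩ := exists_lt (min μ (-lowerBound a b M))
    rw [lt_min_iff] at hν
    rw [← hfl hν.2, Int.add_one_le_iff, Int.floor_lt, div_lt_iff₀ hπ, ← hμ]
    linarith [endAngle_strictMono a hq hν.1]
  · intro hk
    obtain ⟨ν, hν⟩ := exists_lt (-lowerBound a b M)
    rw [← hfl hν] at hk
    have h1 : endAngle a q ν + b ≤ k * Real.pi := by
      rw [← div_le_iff₀ hπ]
      refine (Int.lt_floor_add_one _).le.trans ?_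
      exact_mod_cast hk
    obtain ⟨ν', hν'⟩ := (eventually_lt_pruferAngle hq (-a) (k * Real.pi - b)).exists
    have h2 := hν' _ (prufer_zero _ _)
      (isPruferAngle_prufer (-a) (intervalIntegrable_sub_const hq ν'))
    exact mem_range_of_exists_le_of_exists_ge
      ((endAngle_continuous a hq).add continuous_const) ⟨ν, h1⟩
      ⟨ν', by change k * Real.pi ≤ endAngle a q ν' + b; rw [endAngle]; linarith⟩

end

/-! ### Eigenvalues of square integrable potentials -/

theorem intervalIntegrable_coe (q : L2) : IntervalIntegrable q volume 0 1 := by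
  rw [intervalIntegrable_iff_integrableOn_Icc_of_le zero_le_one]
  exact (Lp.memLp q).integrable (by norm_num)

theorem isSol_of_isSolution {q : L2} {μ : ℝ} {u v : ℝ → ℝ} (h : IsSolution q μ u v) :
    IsSol (fun x => q x - μ) u v := by
  have hu : ContinuousOn u (Icc 0 1) := fun x hx => (h.hasDeriv x hx).continuousWithinAt
  have hv : HasACDeriv v fun x => (q x - μ) * u x :=
    HasACDeriv.of_integral ((intervalIntegrable_sub_const (intervalIntegrable_coe q) μ).mul_contOn hu)
      h.integral_eq
  refine ⟨HasACDeriv.of_integral hv.continuousOn.intervalIntegrable_unit fun x hx => ?_, hv⟩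
  rw [intervalIntegral.integral_eq_sub_of_hasDerivAt_of_le hx.1
    (hu.mono (Icc_subset_Icc_right hx.2)) (fun y hy => ?_)
    (hv.continuousOn.intervalIntegrable_unit.mono_unit zero_mem_unit hx)]
  · ring
  · exact (h.hasDeriv y ⟨hy.1.le, hy.2.le.trans hx.2⟩).hasDerivAt
      (Icc_mem_nhds hy.1 (hy.2.trans_le hx.2))

theorem IsSol.isSolution {q : L2} {μ : ℝ} {u v : ℝ → ℝ} (h : IsSol (fun x => q x - μ) u v) :
    IsSolution q μ u v := by
  refine ⟨fun x hx => ?_, fun x hx => ?_⟩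
  -- The continuous extension of `v` turns the one-sided derivatives at the endpoints into two-sided
  -- derivatives of its integral.
  · have hc : Continuous (IccExtend zero_le_one ((Icc (0 : ℝ) 1).domRestrict v)) :=
      (continuousOn_iff_continuous_domRestrict.1 h.continuousOn_snd).Icc_extend'
    have he : ∀ y ∈ Icc (0 : ℝ) 1,
        IccExtend zero_le_one ((Icc (0 : ℝ) 1).domRestrict v) y = v y := fun y hy => by
      rw [IccExtend_of_mem _ _ hy]; rfl
    have hd := (intervalIntegral.integral_hasDerivAt_right (hc.intervalIntegrable 0 x)
      (hc.stronglyMeasurableAtFilter _ _) hc.continuousAt).const_add (u 0)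
    rw [he x hx] at hd
    have hu : ∀ y ∈ Icc (0 : ℝ) 1, u y =
        u 0 + ∫ s in (0 : ℝ)..y, IccExtend zero_le_one ((Icc (0 : ℝ) 1).domRestrict v) s := by
      intro y hy
      have e := h.fst.integral_eq zero_mem_unit hy
      rw [intervalIntegral.integral_congr (g := v) fun s hs => he s (by
        rw [uIcc_of_le hy.1] at hs; exact ⟨hs.1, hs.2.trans hy.2⟩), e]
      ring
    exact hd.hasDerivWithinAt.congr hu (hu x hx)
  · rw [h.snd.integral_eq zero_mem_unit hx]; ring

/-- The left boundary condition makes the Wronskian with `solU` vanish, so the eigenvalues are the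
parameters for which `solU` satisfies the right boundary condition. -/
theorem isEigenvalue_iff (q : L2) (a b μ : ℝ) :
    IsEigenvalue q a b μ ↔ Real.sin (endAngle a q μ + b) = 0 := by
  have hp := intervalIntegrable_sub_const (intervalIntegrable_coe q) μ
  have h1 := isSol_sol (-a) hp
  constructor
  · rintro ⟨u, v, huv, h0, hb, x, hx, hne⟩
    by_contra hs
    have hsol := isSol_of_isSolution huv
    have e := hsol.wronskian_eq h1 one_mem_unit zero_mem_unit
    rw [solU_zero, solV_zero, Real.sin_neg, Real.cos_neg] at e
    have hr := Real.exp_pos (logAmp (fun x => q x - μ) (prufer (-a) fun x => q x - μ) 1)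
    have e2 : u 1 * Real.cos (endAngle a q μ) - v 1 * Real.sin (endAngle a q μ) = 0 := by
      refine (mul_eq_zero.1 (?_ : Real.exp _ * _ = 0)).resolve_left hr.ne'
      simp only [solU, solV] at e
      simp only [endAngle]
      linear_combination e + h0
    rw [Real.sin_add] at hs
    have hu1 : u 1 = 0 := by
      refine (mul_eq_zero.1 (?_ : _ * u 1 = 0)).resolve_left hs
      linear_combination Real.sin b * e2 + Real.sin (endAngle a q μ) * hb
    have hv1 : v 1 = 0 := by
      refine (mul_eq_zero.1 (?_ : _ * v 1 = 0)).resolve_left hs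
      linear_combination -Real.cos b * e2 + Real.cos (endAngle a q μ) * hb
    exact hne (hsol.eq_zero hp one_mem_unit hu1 hv1 hx)
  · intro h
    refine ⟨_, _, h1.isSolution, ?_, ?_, exists_solU_ne_zero _ hp⟩
    · rw [solU_mul_cos_add, prufer_zero]; simp
    · rw [solU_mul_cos_add]
      exact mul_eq_zero_of_right _ h

/-- The `n`-th eigenvalue is where the Prüfer angle reaches its level `firstIndex a b + n`. -/
theorem endAngle_eigenvalue (q : L2) (a b : ℝ) (n : ℕ) :
    endAngle a q (eigenvalue q a b n) + b = (firstIndex a b + n) * Real.pi := by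
  have hq := intervalIntegrable_coe q
  have hπ := Real.pi_pos
  have hmono := endAngle_strictMono a hq
  have hex : ∀ n : ℕ, ∃ μ, endAngle a q μ + b = ((firstIndex a b + n : ℤ) : ℝ) * Real.pi :=
    fun n => (exists_endAngle_add_eq_iff hq _).2 (by omega)
  -- `m j` is the parameter at the level `firstIndex a b + j`; these are all the eigenvalues.
  choose m hm using hex
  have hmlt : ∀ i j : ℕ, m i < m j ↔ i < j := fun i j => by
    rw [← hmono.lt_iff_lt, ← add_lt_add_iff_right b, hm, hm, mul_lt_mul_iff_left₀ hπ]
    push_cast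
    simp
  have hev : ∀ μ, IsEigenvalue q a b μ ↔ ∃ j, μ = m j := by
    intro μ
    rw [isEigenvalue_iff, Real.sin_eq_zero_iff]
    constructor
    · rintro ⟨k, hk⟩
      have hk' := (exists_endAngle_add_eq_iff (a := a) (b := b) hq k).1 ⟨μ, hk.symm⟩
      obtain ⟨j, rfl⟩ := Int.le.dest hk'
      refine ⟨j, hmono.injective (add_right_cancel (b := b) ?_)⟩
      rw [hm, ← hk]
    · rintro ⟨j, rfl⟩
      exact ⟨_, (hm j).symm⟩
  have hcount : ∀ j : ℕ, {ν : ℝ | IsEigenvalue q a b ν ∧ ν < m j}.encard = j := by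
    intro j
    have hset : {ν : ℝ | IsEigenvalue q a b ν ∧ ν < m j} = m '' (Finset.range j : Set ℕ) := by
      ext ν
      simp only [mem_ofPred_eq, hev, mem_image, Finset.coe_range, mem_Iio]
      constructor
      · rintro ⟨⟨i, rfl⟩, hi⟩
        exact ⟨i, (hmlt i j).1 hi, rfl⟩
      · rintro ⟨i, hi, rfl⟩
        exact ⟨⟨i, rfl⟩, (hmlt i j).2 hi⟩
    have hinj : Function.Injective m := fun i j hij => by
      rcases lt_trichotomy i j with h | h | h
      · exact absurd hij ((hmlt i j).2 h).ne
      · exact h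
      · exact absurd hij ((hmlt j i).2 h).ne'
    rw [hset, hinj.encard_image, encard_coe_eq_coe_finsetCard, Finset.card_range]
  have hsing : {μ : ℝ | IsEigenvalue q a b μ ∧
      {ν : ℝ | IsEigenvalue q a b ν ∧ ν < μ}.encard = n} = {m n} := by
    ext μ
    simp only [mem_ofPred_eq, mem_singleton_iff]
    constructor
    · rintro ⟨h1, h2⟩
      obtain ⟨j, rfl⟩ := (hev μ).1 h1
      have h3 := (hcount j).symm.trans h2
      rw [Nat.cast_inj.1 h3]
    · rintro rfl
      exact ⟨(hev _).2 ⟨n, rfl⟩, hcount n⟩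
  rw [eigenvalue, hsing, csInf_singleton, hm]
  push_cast
  ring

/-! ### Eigenvalues along lines of potentials -/

theorem integral_congr_restrict {f g : ℝ → ℝ} (h : f =ᵐ[volume.restrict (Icc (0 : ℝ) 1)] g) :
    ∫ x in (0 : ℝ)..1, f x = ∫ x in (0 : ℝ)..1, g x := by
  refine intervalIntegral.integral_congr_ae ?_
  filter_upwards [(ae_restrict_iff' measurableSet_Icc).1 h] with x hx hx'
  rw [uIoc_of_le zero_le_one] at hx'
  exact hx (Ioc_subset_Icc_self hx')

theorem coe_line (q h : L2) (t : ℝ) :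
    ⇑(q + t • h) =ᵐ[volume.restrict (Icc (0 : ℝ) 1)] fun x => q x + t * h x := by
  filter_upwards [Lp.coeFn_add q (t • h), Lp.coeFn_smul t h] with x h1 h2
  rw [h1, Pi.add_apply, h2, Pi.smul_apply, smul_eq_mul]

theorem integral_abs_line_sub (q h : L2) (s t : ℝ) :
    ∫ x in (0 : ℝ)..1, |(q + s • h) x - (q + t • h) x| = |s - t| * ∫ x in (0 : ℝ)..1, |h x| := by
  rw [← intervalIntegral.integral_const_mul]
  refine integral_congr_restrict ?_
  filter_upwards [coe_line q h s, coe_line q h t] with x h1 h2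
  rw [h1, h2, ← abs_mul]; congr 1; ring

theorem integral_abs_line_le (q h : L2) (t : ℝ) :
    ∫ x in (0 : ℝ)..1, |(q + t • h) x| ≤
      (∫ x in (0 : ℝ)..1, |q x|) + |t| * ∫ x in (0 : ℝ)..1, |h x| := by
  have hq := intervalIntegrable_coe q
  have hh := intervalIntegrable_coe h
  rw [← intervalIntegral.integral_const_mul,
    ← intervalIntegral.integral_add hq.abs (hh.abs.const_mul _)]
  rw [integral_congr_restrict (g := fun x => |q x + t * h x|)
    (by filter_upwards [coe_line q h t] with x hx; rw [hx])]
  refine integral_mono_unit (hq.add (hh.const_mul t)).abs (hq.abs.add (hh.abs.const_mul _))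
    fun x _ => ?_
  rw [← abs_mul]; exact abs_add_le _ _

/-- The coefficient `p = q - λ` in `u'' = p u`, for the `n`-th eigenvalue `λ` of `q`. -/
noncomputable def eigenCoeff (q : L2) (a b : ℝ) (n : ℕ) (x : ℝ) : ℝ := q x - eigenvalue q a b n

/-- The eigenfunction of the `n`-th eigenvalue with `(u, u') = (-sin a, cos a)` at `0`. -/
noncomputable def eigenFun (q : L2) (a b : ℝ) (n : ℕ) : ℝ → ℝ := solU (-a) (eigenCoeff q a b n)

/-- The derivative of `eigenFun`. -/
noncomputable def eigenFunDeriv (q : L2) (a b : ℝ) (n : ℕ) : ℝ → ℝ :=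
  solV (-a) (eigenCoeff q a b n)

/-- The square of the eigenfunction, normalized to have integral `1`. -/
noncomputable def sqEigenFun (q : L2) (a b : ℝ) (n : ℕ) (x : ℝ) : ℝ :=
  eigenFun q a b n x ^ 2 / ∫ s in (0 : ℝ)..1, eigenFun q a b n s ^ 2

section

variable (q h : L2) (a b : ℝ) (n : ℕ)

theorem intervalIntegrable_eigenCoeff : IntervalIntegrable (eigenCoeff q a b n) volume 0 1 :=
  intervalIntegrable_sub_const (intervalIntegrable_coe q) _

theorem isSol_eigenFun :
    IsSol (fun x => q x - eigenvalue q a b n) (eigenFun q a b n) (eigenFunDeriv q a b n) :=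
  isSol_sol (-a) (intervalIntegrable_eigenCoeff q a b n)

theorem continuousOn_eigenFun : ContinuousOn (eigenFun q a b n) (Icc 0 1) :=
  (isSol_eigenFun q a b n).continuousOn_fst

theorem eigenFun_zero : eigenFun q a b n 0 = -Real.sin a := by
  rw [eigenFun, solU_zero, Real.sin_neg]

theorem eigenFunDeriv_zero : eigenFunDeriv q a b n 0 = Real.cos a := by
  rw [eigenFunDeriv, solV_zero, Real.cos_neg]

theorem eigenFun_bc_zero :
    eigenFun q a b n 0 * Real.cos a + eigenFunDeriv q a b n 0 * Real.sin a = 0 := by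
  rw [eigenFun_zero, eigenFunDeriv_zero]; ring

theorem eigenFun_bc_one :
    eigenFun q a b n 1 * Real.cos b + eigenFunDeriv q a b n 1 * Real.sin b = 0 := by
  rw [eigenFun, eigenFunDeriv, solU_mul_cos_add]
  refine mul_eq_zero_of_right _ ?_
  have h1 := endAngle_eigenvalue q a b n
  rw [endAngle] at h1
  unfold eigenCoeff
  rw [h1, Real.sin_eq_zero_iff]
  exact ⟨firstIndex a b + n, by push_cast; ring⟩

theorem integral_eigenFun_sq_pos : 0 < ∫ s in (0 : ℝ)..1, eigenFun q a b n s ^ 2 :=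
  integral_solU_sq_pos (-a) (intervalIntegrable_eigenCoeff q a b n)

theorem continuousOn_sqEigenFun : ContinuousOn (sqEigenFun q a b n) (Icc 0 1) :=
  ((continuousOn_eigenFun q a b n).pow 2).div_const _

theorem abs_sqEigenFun_le {M : ℝ} (hM : ∫ s in (0 : ℝ)..1, |q s| ≤ M) {x : ℝ}
    (hx : x ∈ Icc (0 : ℝ) 1) : |sqEigenFun q a b n x| ≤ supBound a b M := by
  have hN := integral_eigenFun_sq_pos q a b n
  rw [sqEigenFun, abs_of_nonneg (div_nonneg (sq_nonneg _) hN.le), div_le_iff₀ hN]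
  exact (isSol_eigenFun q a b n).sq_le_supBound (intervalIntegrable_coe q) hM
    (eigenFun_bc_zero q a b n) (eigenFun_bc_one q a b n) hx

theorem abs_integral_mul_sqEigenFun_le {f : ℝ → ℝ} (hf : IntervalIntegrable f volume 0 1) {M : ℝ}
    (hM : ∫ s in (0 : ℝ)..1, |q s| ≤ M) :
    |∫ x in (0 : ℝ)..1, f x * sqEigenFun q a b n x| ≤
      supBound a b M * ∫ x in (0 : ℝ)..1, |f x| := by
  rw [← intervalIntegral.integral_const_mul]
  refine abs_integral_le_unit (hf.abs.const_mul _) (fun s hs => ?_) one_mem_unit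
  rw [abs_mul, mul_comm]
  gcongr
  exact abs_sqEigenFun_le q a b n hM hs

/-- The `n`-th eigenvalue is where a strictly increasing function attains a fixed level, and this
function varies continuously along the line. -/
theorem continuous_eigenvalue_line :
    Continuous fun t : ℝ => eigenvalue (q + t • h) a b n := by
  have hΘ : ∀ μ, Continuous fun t : ℝ => endAngle a ⇑(q + t • h) μ := fun μ => by
    refine continuous_prufer_one (P := fun t x => (q + t • h) x - μ) (-a)
      (fun t => intervalIntegrable_sub_const (intervalIntegrable_coe _) μ) fun t₀ => ?_
    simp only [sub_sub_sub_cancel_right, integral_abs_line_sub]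
    exact Continuous.tendsto' (by fun_prop) _ _ (by simp)
  refine continuous_iff_continuousAt.2 fun t₀ => Metric.tendsto_nhds.2 fun ε hε => ?_
  set μ₀ := eigenvalue (q + t₀ • h) a b n with hμ₀
  have hmono := fun t : ℝ => endAngle_strictMono a (intervalIntegrable_coe (q + t • h))
  have hlev : ∀ t : ℝ, endAngle a ⇑(q + t • h) (eigenvalue (q + t • h) a b n) =
      endAngle a ⇑(q + t₀ • h) μ₀ := fun t => by
    have h1 := endAngle_eigenvalue (q + t • h) a b n
    have h2 := endAngle_eigenvalue (q + t₀ • h) a b n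
    rw [hμ₀]; linarith
  have h1 := (hΘ (μ₀ - ε)).continuousAt.eventually_lt continuousAt_const
    (hmono t₀ (show μ₀ - ε < μ₀ by linarith))
  have h2 := (continuousAt_const (x := t₀)).eventually_lt (hΘ (μ₀ + ε)).continuousAt
    (hmono t₀ (show μ₀ < μ₀ + ε by linarith))
  filter_upwards [h1, h2] with t ht1 ht2
  rw [← hlev t, (hmono t).lt_iff_lt] at ht1 ht2
  rw [Real.dist_eq, abs_lt]
  constructor <;> linarith

/-- Eigenfunctions for the same index at two potentials on a line satisfy Lagrange's identity
without boundary terms. -/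
theorem lagrange_eigenFun_line (s t : ℝ) :
    (s - t) * ∫ x in (0 : ℝ)..1, h x *
        (eigenFun (q + s • h) a b n x * eigenFun (q + t • h) a b n x) =
      (eigenvalue (q + s • h) a b n - eigenvalue (q + t • h) a b n) *
        ∫ x in (0 : ℝ)..1, eigenFun (q + s • h) a b n x * eigenFun (q + t • h) a b n x := by
  have hW := ((isSol_eigenFun (q + t • h) a b n).wronskian
    (isSol_eigenFun (q + s • h) a b n)).integral_eq zero_mem_unit one_mem_unit
  have hc : ContinuousOn (fun x => eigenFun (q + s • h) a b n x * eigenFun (q + t • h) a b n x)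
      (Icc 0 1) := (continuousOn_eigenFun _ a b n).mul (continuousOn_eigenFun _ a b n)
  have b1 := eigenFun_bc_one (q + s • h) a b n
  have b2 := eigenFun_bc_one (q + t • h) a b n
  have e1 := bc_wronskian_eq_zero b2 b1
  rw [e1, eigenFun_zero, eigenFun_zero, eigenFunDeriv_zero, eigenFunDeriv_zero] at hW
  have hI1 := (intervalIntegrable_coe h).mul_contOn hc
  rw [integral_congr_restrict (g := fun x => (s - t) *
    (h x * (eigenFun (q + s • h) a b n x * eigenFun (q + t • h) a b n x)) -
      (eigenvalue (q + s • h) a b n - eigenvalue (q + t • h) a b n) *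
      (eigenFun (q + s • h) a b n x * eigenFun (q + t • h) a b n x)) (by
    filter_upwards [coe_line q h s, coe_line q h t] with x h1 h2
    rw [h1, h2]; ring), intervalIntegral.integral_sub (hI1.const_mul _)
      (hc.intervalIntegrable_unit.const_mul _), intervalIntegral.integral_const_mul,
    intervalIntegral.integral_const_mul] at hW
  linarith

theorem tendsto_integral_mul_eigenFun_line (t : ℝ) {f : ℝ → ℝ}
    (hf : IntervalIntegrable f volume 0 1) :
    Tendsto (fun s : ℝ => ∫ x in (0 : ℝ)..1, f x *
      (eigenFun (q + s • h) a b n x * eigenFun (q + t • h) a b n x)) (𝓝 t)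
      (𝓝 (∫ x in (0 : ℝ)..1, f x * eigenFun (q + t • h) a b n x ^ 2)) := by
  set N := ∫ x in (0 : ℝ)..1, |1 + eigenCoeff (q + t • h) a b n x|
  set D : ℝ → ℝ := fun s => |s - t| * (∫ x in (0 : ℝ)..1, |h x|) +
    |eigenvalue (q + s • h) a b n - eigenvalue (q + t • h) a b n|
  have hD : Tendsto D (𝓝 t) (𝓝 0) := by
    have hc := continuous_eigenvalue_line q h a b n
    exact Continuous.tendsto' (by fun_prop) _ _ (by simp [D])
  set d : ℝ → ℝ := fun s => ∫ x in (0 : ℝ)..1,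
    |eigenCoeff (q + s • h) a b n x - eigenCoeff (q + t • h) a b n x|
  have hdD : ∀ s, d s ≤ D s := fun s => by
    simp only [d, D]
    rw [← integral_abs_line_sub q h s t]
    have hqs := intervalIntegrable_coe (q + s • h)
    have hqt := intervalIntegrable_coe (q + t • h)
    have e : ∀ c : ℝ, |c| = ∫ x in (0 : ℝ)..1, |c| := fun c => by simp
    rw [e (_ - _),
      ← intervalIntegral.integral_add (hqs.sub hqt).abs intervalIntegrable_const]
    refine integral_mono_unit ((intervalIntegrable_eigenCoeff _ a b n).sub
      (intervalIntegrable_eigenCoeff _ a b n)).abs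
      ((hqs.sub hqt).abs.add intervalIntegrable_const) fun x _ => ?_
    simp only [eigenCoeff]
    rw [sub_sub_sub_comm]
    exact abs_sub _ _
  have hd : Tendsto d (𝓝 t) (𝓝 0) := squeeze_zero (fun s =>
    intervalIntegral.integral_nonneg zero_le_one fun _ _ => abs_nonneg _) hdD hD
  have hct := continuousOn_eigenFun (q + t • h) a b n
  have hft := hf.mul_contOn hct
  have hft2 : IntervalIntegrable (fun x => f x * eigenFun (q + t • h) a b n x ^ 2) volume 0 1 :=
    hf.mul_contOn (hct.pow 2)
  refine tendsto_iff_dist_tendsto_zero.2 (squeeze_zero (fun _ => dist_nonneg) (fun s => ?_)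
    (g := fun s => solModulus N (d s) * ∫ x in (0 : ℝ)..1, |f x * eigenFun (q + t • h) a b n x|) ?_)
  · have hfst : IntervalIntegrable (fun x => f x * (eigenFun (q + s • h) a b n x *
        eigenFun (q + t • h) a b n x)) volume 0 1 :=
      hf.mul_contOn ((continuousOn_eigenFun (q + s • h) a b n).mul hct)
    rw [Real.dist_eq, ← intervalIntegral.integral_sub hfst hft2,
      ← intervalIntegral.integral_const_mul]
    refine abs_integral_le_unit (hft.abs.const_mul _) (fun x hx => ?_) one_mem_unit
    have h1 := abs_solU_sub_le (-a) (intervalIntegrable_eigenCoeff (q + s • h) a b n)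
      (intervalIntegrable_eigenCoeff (q + t • h) a b n) hx
    have e : f x * (eigenFun (q + s • h) a b n x * eigenFun (q + t • h) a b n x) -
        f x * eigenFun (q + t • h) a b n x ^ 2 =
        (eigenFun (q + s • h) a b n x - eigenFun (q + t • h) a b n x) *
        (f x * eigenFun (q + t • h) a b n x) := by ring
    rw [e, abs_mul]
    exact mul_le_mul_of_nonneg_right h1 (abs_nonneg _)
  · simpa using ((tendsto_solModulus N).comp hd).mul_const
      (∫ x in (0 : ℝ)..1, |f x * eigenFun (q + t • h) a b n x|)

/-- The derivative of an eigenvalue in a direction `h` is the integral of `h` against the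
normalized square of the eigenfunction. -/
theorem hasDerivAt_eigenvalue_line (t : ℝ) :
    HasDerivAt (fun t : ℝ => eigenvalue (q + t • h) a b n)
      (∫ x in (0 : ℝ)..1, h x * sqEigenFun (q + t • h) a b n x) t := by
  have hN := integral_eigenFun_sq_pos (q + t • h) a b n
  have h1 := tendsto_integral_mul_eigenFun_line q h a b n t (intervalIntegrable_coe h)
  have h2 := tendsto_integral_mul_eigenFun_line q h a b n t
    (f := fun _ => 1) intervalIntegrable_const
  simp only [one_mul] at h2
  have h3 : ∫ x in (0 : ℝ)..1, h x * sqEigenFun (q + t • h) a b n x =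
      (∫ x in (0 : ℝ)..1, h x * eigenFun (q + t • h) a b n x ^ 2) /
        ∫ x in (0 : ℝ)..1, eigenFun (q + t • h) a b n x ^ 2 := by
    rw [← intervalIntegral.integral_div]
    simp only [sqEigenFun, mul_div_assoc]
  rw [h3, hasDerivAt_iff_tendsto_slope]
  refine ((h1.div h2 hN.ne').mono_left nhdsWithin_le_nhds).congr' ?_
  filter_upwards [nhdsWithin_le_nhds (h2.eventually_ne hN.ne'), self_mem_nhdsWithin] with s hs hst
  have hst' : s - t ≠ 0 := sub_ne_zero.2 hst
  have h4 := lagrange_eigenFun_line q h a b n s t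
  rw [slope_def_field, Pi.div_apply, div_eq_div_iff hs hst']
  linarith

/-- Lipschitz bound for the eigenvalues, uniform in the index. -/
theorem abs_eigenvalue_line_sub_le {M : ℝ}
    (hM : ∀ t ∈ Icc (-1 : ℝ) 1, ∫ s in (0 : ℝ)..1, |(q + t • h) s| ≤ M) {t : ℝ}
    (ht : t ∈ Icc (-1 : ℝ) 1) :
    |eigenvalue (q + t • h) a b n - eigenvalue q a b n| ≤
      supBound a b M * ∫ x in (0 : ℝ)..1, |h x| := by
  have h0 : (0 : ℝ) ∈ Icc (-1 : ℝ) 1 := by constructor <;> norm_num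
  have h1 := (convex_Icc (-1 : ℝ) 1).norm_image_sub_le_of_norm_hasDerivWithin_le
    (fun s _ => (hasDerivAt_eigenvalue_line q h a b n s).hasDerivWithinAt)
    (fun s hs => abs_integral_mul_sqEigenFun_le (q + s • h) a b n (intervalIntegrable_coe h)
      (hM s hs)) h0 ht
  simp only [zero_smul, add_zero, sub_zero, Real.norm_eq_abs] at h1
  refine h1.trans (mul_le_of_le_one_right ?_ (abs_le.2 ht))
  exact (abs_nonneg _).trans (abs_integral_mul_sqEigenFun_le _ a b n (intervalIntegrable_coe h)
      (hM t ht))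

end

/-! ### Biorthogonality of squared eigenfunctions -/

namespace IsSol

variable {q f f' g g' h h' : ℝ → ℝ} {ν μ : ℝ}

/-- The square of a solution paired with the derivative of a product of two solutions for another
spectral parameter yields only boundary terms. -/
theorem integral_sq_mul_deriv (hf : IsSol (fun x => q x - ν) f f')
    (hg : IsSol (fun x => q x - μ) g g') (hh : IsSol (fun x => q x - μ) h h') (hne : ν ≠ μ)
    (h0 : f 0 * g' 0 - f' 0 * g 0 = 0)
    (h1 : f 1 * g' 1 - f' 1 * g 1 = 0 ∨ f 1 * h' 1 - f' 1 * h 1 = 0) :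
    2 * ∫ x in (0 : ℝ)..1, (g' x * h x + g x * h' x) * f x ^ 2 =
      f 1 ^ 2 * (g 1 * h 1) - f 0 ^ 2 * (g 0 * h 0) := by
  have e := ((((hf.fst.mul hf.fst).mul (hg.fst.mul hh.fst)).const_mul (ν - μ)).add
    ((hf.wronskian hg).mul (hf.wronskian hh))).congr'
    (g' := fun x => 2 * (ν - μ) * ((g' x * h x + g x * h' x) * f x ^ 2)) fun x => by ring
  have e1 := e.integral_eq zero_mem_unit one_mem_unit
  have e2 := mul_eq_zero.2 h1
  rw [intervalIntegral.integral_const_mul, e2, h0] at e1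
  refine mul_left_cancel₀ (sub_ne_zero.2 hne) ?_
  linear_combination e1

/-- The same pairing for equal spectral parameters and `f = g`: in addition to the boundary terms
there is a multiple of the Wronskian of `f` and `h`. -/
theorem integral_sq_mul_deriv_self (hf : IsSol (fun x => q x - μ) f f')
    (hh : IsSol (fun x => q x - μ) h h') :
    2 * ∫ x in (0 : ℝ)..1, (f' x * h x + f x * h' x) * f x ^ 2 =
      f 1 ^ 2 * (f 1 * h 1) - f 0 ^ 2 * (f 0 * h 0) +
        (f 1 * h' 1 - f' 1 * h 1) * ∫ x in (0 : ℝ)..1, f x ^ 2 := by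
  have e := ((hf.fst.mul hf.fst).mul (hf.fst.mul hh.fst)).integral_eq zero_mem_unit one_mem_unit
  have hc : ContinuousOn (fun x => (f' x * h x + f x * h' x) * f x ^ 2) (Icc 0 1) :=
    ((hf.continuousOn_snd.mul hh.continuousOn_fst).add
      (hf.continuousOn_fst.mul hh.continuousOn_snd)).mul (hf.continuousOn_fst.pow 2)
  have e2 : ∫ x in (0 : ℝ)..1, ((f' x * f x + f x * f' x) * (f x * h x) +
      f x * f x * (f' x * h x + f x * h' x)) =
      ∫ x in (0 : ℝ)..1, (2 * ((f' x * h x + f x * h' x) * f x ^ 2) -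
        (f 1 * h' 1 - f' 1 * h 1) * f x ^ 2) := by
    refine intervalIntegral.integral_congr fun x hx => ?_
    rw [uIcc_of_le zero_le_one] at hx
    have hW := hf.wronskian_eq hh hx one_mem_unit
    rw [← hW]; ring
  rw [e2, intervalIntegral.integral_sub (hc.intervalIntegrable_unit.const_mul _)
    (hf.intervalIntegrable_sq_fst.const_mul _), intervalIntegral.integral_const_mul,
    intervalIntegral.integral_const_mul] at e
  linarith

end IsSol

/-- The boundary condition at the right endpoint for the index `k`. -/
def rightAngle (β γ : ℝ) (k : Fin 2 × ℕ) : ℝ := if k.1 = 0 then β else γ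

section

variable {α β γ : ℝ}

theorem sin_rightAngle_sub_ne_zero (hβγ : Real.sin (β - γ) ≠ 0) {k l : Fin 2 × ℕ}
    (hkl : k.1 ≠ l.1) : Real.sin (rightAngle β γ k - rightAngle β γ l) ≠ 0 := by
  have hγβ : Real.sin (γ - β) ≠ 0 := by rwa [← neg_sub, Real.sin_neg, neg_ne_zero]
  unfold rightAngle
  split_ifs with h1 h2 h2
  · exact absurd (h1.trans h2.symm) hkl
  · exact hβγ
  · exact hγβ
  · exact absurd (by omega) hkl

/-- Each spectrum is simple, and the two are disjoint: the angle at `1` cannot be congruent modulo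
`π` to both `-β` and `-γ`. -/
theorem lam_injective (hβγ : Real.sin (β - γ) ≠ 0) (q : L2) :
    Function.Injective (lam α β γ q) := by
  intro k l hkl
  have hπ := Real.pi_pos.ne'
  have h1 := endAngle_eigenvalue q α (rightAngle β γ k) k.2
  have h2 := endAngle_eigenvalue q α (rightAngle β γ l) l.2
  have e : eigenvalue q α (rightAngle β γ k) k.2 = eigenvalue q α (rightAngle β γ l) l.2 := hkl
  rw [e] at h1
  by_cases h : k.1 = l.1
  · have hr : rightAngle β γ k = rightAngle β γ l := by unfold rightAngle; rw [h]
    rw [hr, h2] at h1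
    have h3 := add_left_cancel (mul_right_cancel₀ hπ h1)
    exact Prod.ext h (by exact_mod_cast h3.symm)
  · refine absurd ?_ (sin_rightAngle_sub_ne_zero hβγ h)
    refine Real.sin_eq_zero_iff.2 ⟨firstIndex α (rightAngle β γ k) + k.2 -
      (firstIndex α (rightAngle β γ l) + l.2), ?_⟩
    push_cast
    linarith

/-- For every index `k` there is a continuous function whose integrals against the normalized
squared eigenfunctions `s` consist of boundary terms in `s` and, only for the index `k`, of an
additional nonzero constant. -/
theorem exists_biorthogonal (hβγ : Real.sin (β - γ) ≠ 0) (q : L2) (k : Fin 2 × ℕ) :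
    ∃ (P : ℝ → ℝ) (A B W : ℝ), ContinuousOn P (Icc 0 1) ∧ W ≠ 0 ∧ ∀ l : Fin 2 × ℕ,
      ∫ x in (0 : ℝ)..1, P x * sqEigenFun q α (rightAngle β γ l) l.2 x =
        sqEigenFun q α (rightAngle β γ l) l.2 1 * A + sqEigenFun q α (rightAngle β γ l) l.2 0 * B +
          if l = k then W else 0 := by
  obtain ⟨j, hj⟩ : ∃ j : Fin 2, k.1 ≠ j := ⟨k.1 + 1, by omega⟩
  set b := rightAngle β γ k with hb
  set c := rightAngle β γ (j, 0) with hc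
  have hbc : Real.sin (b - c) ≠ 0 := sin_rightAngle_sub_ne_zero hβγ hj
  set μ := eigenvalue q α b k.2 with hμ
  have hg := isSol_eigenFun q α b k.2
  have hp := intervalIntegrable_eigenCoeff q α b k.2
  set g := eigenFun q α b k.2
  set g' := eigenFunDeriv q α b k.2
  have hg1 := eigenFun_bc_one q α b k.2
  change g 1 * Real.cos b + g' 1 * Real.sin b = 0 at hg1
  have hg2 : g 1 * Real.cos c + g' 1 * Real.sin c ≠ 0 := by
    intro h2
    have h3 : g 1 = 0 := by
      refine (mul_eq_zero.1 (?_ : _ * g 1 = 0)).resolve_left hbc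
      rw [Real.sin_sub]
      linear_combination Real.sin b * h2 - Real.sin c * hg1
    have h4 : g' 1 = 0 := by
      refine (mul_eq_zero.1 (?_ : _ * g' 1 = 0)).resolve_left hbc
      rw [Real.sin_sub]
      linear_combination Real.cos c * hg1 - Real.cos b * h2
    obtain ⟨x, hx, hne⟩ := exists_solU_ne_zero (-α) hp
    exact hne (hg.eq_zero hp one_mem_unit h3 h4 hx)
  -- `w` is a second solution, and `h` the combination of `g` and `w` that satisfies the other
  -- boundary condition at `1`.
  have hw := isSol_sol (-α + Real.pi / 2) hp
  set w := solU (-α + Real.pi / 2) (eigenCoeff q α b k.2)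
  set w' := solV (-α + Real.pi / 2) (eigenCoeff q α b k.2)
  have hgw : g 1 * w' 1 - g' 1 * w 1 = -1 := by
    rw [IsSol.wronskian_eq hg hw one_mem_unit zero_mem_unit]
    simp only [g, g', w, w', eigenFun_zero, eigenFunDeriv_zero, solU_zero, solV_zero,
      Real.sin_add_pi_div_two, Real.cos_add_pi_div_two, Real.sin_neg, Real.cos_neg]
    linear_combination -Real.sin_sq_add_cos_sq α
  have hh := IsSol.lin_comb hg hw (w 1 * Real.cos c + w' 1 * Real.sin c)
    (-(g 1 * Real.cos c + g' 1 * Real.sin c))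
  set h : ℝ → ℝ := fun x => (w 1 * Real.cos c + w' 1 * Real.sin c) * g x +
    -(g 1 * Real.cos c + g' 1 * Real.sin c) * w x with hdef
  set h' : ℝ → ℝ := fun x => (w 1 * Real.cos c + w' 1 * Real.sin c) * g' x +
    -(g 1 * Real.cos c + g' 1 * Real.sin c) * w' x with hdef'
  have hh1 : h 1 * Real.cos c + h' 1 * Real.sin c = 0 := by
    simp only [hdef, hdef']; ring
  have hgh : g 1 * h' 1 - g' 1 * h 1 = g 1 * Real.cos c + g' 1 * Real.sin c := by
    simp only [hdef, hdef']
    linear_combination (-(g 1 * Real.cos c + g' 1 * Real.sin c)) * hgw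
  refine ⟨fun x => g' x * h x + g x * h' x, g 1 * h 1 / 2, -(g 0 * h 0) / 2,
    (g 1 * h' 1 - g' 1 * h 1) / 2, ?_, ?_, fun l => ?_⟩
  · exact (hg.continuousOn_snd.mul hh.continuousOn_fst).add
      (hg.continuousOn_fst.mul hh.continuousOn_snd)
  · rw [hgh]; exact div_ne_zero hg2 two_ne_zero
  · have hN := integral_eigenFun_sq_pos q α (rightAngle β γ l) l.2
    have e : ∫ x in (0 : ℝ)..1, (g' x * h x + g x * h' x) *
        sqEigenFun q α (rightAngle β γ l) l.2 x =
        (∫ x in (0 : ℝ)..1, (g' x * h x + g x * h' x) * eigenFun q α (rightAngle β γ l) l.2 x ^ 2) /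
        ∫ s in (0 : ℝ)..1, eigenFun q α (rightAngle β γ l) l.2 s ^ 2 := by
      rw [← intervalIntegral.integral_div]
      simp only [sqEigenFun, mul_div_assoc]
    rw [e]
    split_ifs with hlk
    · subst hlk
      have e2 := IsSol.integral_sq_mul_deriv_self hg hh
      simp only [sqEigenFun]
      rw [← hb]
      change 0 < ∫ s in (0 : ℝ)..1, g s ^ 2 at hN
      change (∫ x in (0 : ℝ)..1, (g' x * h x + g x * h' x) * g x ^ 2) / (∫ x in (0 : ℝ)..1, g x ^ 2) =
        g 1 ^ 2 / (∫ x in (0 : ℝ)..1, g x ^ 2) * (g 1 * h 1 / 2) +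
        g 0 ^ 2 / (∫ x in (0 : ℝ)..1, g x ^ 2) * (-(g 0 * h 0) / 2) +
        (g 1 * h' 1 - g' 1 * h 1) / 2
      generalize (∫ x in (0 : ℝ)..1, (g' x * h x + g x * h' x) * g x ^ 2) = J at e2 ⊢
      generalize (∫ x in (0 : ℝ)..1, g x ^ 2) = N at e2 hN ⊢
      field_simp
      linear_combination e2
    · have hf := isSol_eigenFun q α (rightAngle β γ l) l.2
      have hf1 := eigenFun_bc_one q α (rightAngle β γ l) l.2
      have hne : eigenvalue q α (rightAngle β γ l) l.2 ≠ μ :=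
        fun h => hlk (lam_injective (α := α) hβγ q h)
      have e2 := IsSol.integral_sq_mul_deriv hf hg hh hne
        (bc_wronskian_eq_zero (eigenFun_bc_zero _ _ _ _) (eigenFun_bc_zero _ _ _ _)) (by
          by_cases hl : l.1 = k.1
          · left
            have hr : rightAngle β γ l = b := by rw [hb]; unfold rightAngle; rw [hl]
            rw [hr] at hf1 ⊢
            exact bc_wronskian_eq_zero hf1 hg1
          · right
            have hl' : l.1 = j := by omega
            have hr : rightAngle β γ l = c := by rw [hc]; unfold rightAngle; rw [hl']
            rw [hr] at hf1 ⊢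
            exact bc_wronskian_eq_zero hf1 hh1)
      simp only [sqEigenFun]
      have hN' := hN.ne'
      field_simp
      linear_combination e2

/-- Integration of an absolutely convergent series of uniformly bounded continuous functions. -/
theorem hasSum_mul_integral {ι : Type*} [Countable ι] {c : ι → ℝ} {s : ι → ℝ → ℝ} {C : ℝ}
    (hc : Summable fun k => |c k|) (hs : ∀ k, ContinuousOn (s k) (Icc 0 1))
    (hC : ∀ k, ∀ x ∈ Icc (0 : ℝ) 1, |s k x| ≤ C) {ψ : ℝ → ℝ}
    (hψ : IntervalIntegrable ψ volume 0 1) :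
    HasSum (fun k => c k * ∫ x in (0 : ℝ)..1, ψ x * s k x)
      (∫ x in (0 : ℝ)..1, ψ x * ∑' k, c k * s k x) := by
  have hbd : ∀ k, ∀ x ∈ Icc (0 : ℝ) 1, |c k * s k x| ≤ |c k| * C := fun k x hx => by
    rw [abs_mul]; exact mul_le_mul_of_nonneg_left (hC k x hx) (abs_nonneg _)
  have hsub : ∀ {x : ℝ}, x ∈ uIoc (0 : ℝ) 1 → x ∈ Icc (0 : ℝ) 1 := fun hx => by
    rw [uIoc_of_le zero_le_one] at hx; exact Ioc_subset_Icc_self hx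
  have h := intervalIntegral.hasSum_integral_of_dominated_convergence (μ := volume) (a := 0) (b := 1)
    (F := fun k x => ψ x * (c k * s k x)) (f := fun x => ψ x * ∑' k, c k * s k x)
    (fun k x => |ψ x| * (|c k| * C))
    (fun k => by
      have : IntervalIntegrable (fun x => ψ x * (c k * s k x)) volume 0 1 :=
        hψ.mul_contOn (continuousOn_const.mul (hs k))
      exact this.aestronglyMeasurable_restrict_uIoc)
    (fun k => ae_of_all _ fun x hx => by
      rw [Real.norm_eq_abs, abs_mul]
      exact mul_le_mul_of_nonneg_left (hbd k x (hsub hx)) (abs_nonneg _))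
    (ae_of_all _ fun x _ => (hc.mul_right C).mul_left _)
    (by simp only [tsum_mul_left]; exact hψ.abs.mul_const _)
    (ae_of_all _ fun x hx => HasSum.mul_left _ (Summable.hasSum
      (Summable.of_norm_bounded (hc.mul_right C) fun k => hbd k x (hsub hx))))
  have hcomm : ∀ k, ∫ x in (0 : ℝ)..1, ψ x * (c k * s k x) = c k * ∫ x in (0 : ℝ)..1, ψ x * s k x :=
    fun k => by rw [← intervalIntegral.integral_const_mul]; simp only [mul_left_comm]
  simpa only [hcomm] using h

/-- The normalized squared eigenfunctions for two boundary conditions at `1` are linearly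
independent, even with respect to absolutely convergent infinite combinations. -/
theorem eq_zero_of_tsum_sqEigenFun_eq_zero (hβγ : Real.sin (β - γ) ≠ 0) (q : L2)
    {I : Set (Fin 2 × ℕ)} {c : I → ℝ} (hc : Summable fun k => |c k|) {C : ℝ}
    (hC : ∀ k : I, ∀ x ∈ Icc (0 : ℝ) 1, |sqEigenFun q α (rightAngle β γ k) k.1.2 x| ≤ C)
    (h0 : ∀ x ∈ Icc (0 : ℝ) 1, ∑' k, c k * sqEigenFun q α (rightAngle β γ k) k.1.2 x = 0)
    (k : I) : c k = 0 := by
  obtain ⟨P, A, B, W, hP, hW, hPl⟩ := exists_biorthogonal (α := α) hβγ q k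
  have hsum := hasSum_mul_integral hc (fun k => continuousOn_sqEigenFun q α _ _) hC
    hP.intervalIntegrable_unit
  have hz : ∫ x in (0 : ℝ)..1, P x * ∑' k, c k * sqEigenFun q α (rightAngle β γ k) k.1.2 x = 0 := by
    rw [intervalIntegral.integral_congr (g := fun _ => 0)]
    · simp
    · intro x hx
      rw [uIcc_of_le zero_le_one] at hx
      simp only [h0 x hx, mul_zero]
  rw [hz] at hsum
  have hpt : ∀ x ∈ Icc (0 : ℝ) 1,
      HasSum (fun k => c k * sqEigenFun q α (rightAngle β γ k) k.1.2 x) 0 := fun x hx => by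
    rw [← h0 x hx]
    refine (Summable.of_norm_bounded (hc.mul_right C) fun k => ?_).hasSum
    rw [Real.norm_eq_abs, abs_mul]
    exact mul_le_mul_of_nonneg_left (hC k x hx) (abs_nonneg _)
  have hone : HasSum (fun l : I => if l = k then c k * W else 0) (c k * W) := hasSum_ite_eq k _
  have htot := (((hpt 1 one_mem_unit).mul_right A).add ((hpt 0 zero_mem_unit).mul_right B)).add hone
  have hfun : (fun l : I => c l * ∫ x in (0 : ℝ)..1,
      P x * sqEigenFun q α (rightAngle β γ l) l.1.2 x) = fun l : I =>
      c l * sqEigenFun q α (rightAngle β γ l) l.1.2 1 * A +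
        c l * sqEigenFun q α (rightAngle β γ l) l.1.2 0 * B + if l = k then c k * W else 0 := by
    funext l
    rw [hPl]
    by_cases hl : l = k
    · rw [if_pos hl, if_pos (congrArg Subtype.val hl), hl]; ring
    · rw [if_neg hl, if_neg fun h => hl (Subtype.ext h)]; ring
  rw [hfun] at hsum
  have heq := hsum.unique htot
  rw [zero_mul, zero_mul, zero_add, zero_add] at heq
  exact (mul_eq_zero.1 heq.symm).resolve_right hW

end

/-! ### The least squares functional -/

section

variable {α β γ : ℝ}

/-- The normalized squared eigenfunction with index `k`. -/
noncomputable def sqFun (α β γ : ℝ) (q : L2) (k : Fin 2 × ℕ) : ℝ → ℝ :=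
  sqEigenFun q α (rightAngle β γ k) k.2

theorem hasDerivAt_lam_line (q h : L2) (k : Fin 2 × ℕ) (t : ℝ) :
    HasDerivAt (fun t : ℝ => lam α β γ (q + t • h) k)
      (∫ x in (0 : ℝ)..1, h x * sqFun α β γ (q + t • h) k x) t :=
  hasDerivAt_eigenvalue_line q h α (rightAngle β γ k) k.2 t

/-- Bounds along a segment of potentials that are uniform in the index of the eigenvalue. -/
theorem exists_uniform_bound (α β γ : ℝ) (q h : L2) :
    ∃ C : ℝ, 0 ≤ C ∧ ∀ t ∈ Icc (-1 : ℝ) 1, ∀ k : Fin 2 × ℕ,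
      |lam α β γ (q + t • h) k - lam α β γ q k| ≤ C ∧
      (∀ x ∈ Icc (0 : ℝ) 1, |sqFun α β γ (q + t • h) k x| ≤ C) ∧
      |∫ x in (0 : ℝ)..1, h x * sqFun α β γ (q + t • h) k x| ≤ C := by
  set J := ∫ x in (0 : ℝ)..1, |h x| with hJ
  have hJ0 : 0 ≤ J := intervalIntegral.integral_nonneg zero_le_one fun _ _ => abs_nonneg _
  set M := (∫ x in (0 : ℝ)..1, |q x|) + J with hM
  have hMt : ∀ t ∈ Icc (-1 : ℝ) 1, ∫ s in (0 : ℝ)..1, |(q + t • h) s| ≤ M := fun t ht =>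
    (integral_abs_line_le q h t).trans
      (add_le_add_right (mul_le_of_le_one_left hJ0 (abs_le.2 ht)) _)
  set S := |supBound α β M| + |supBound α γ M| with hS
  have hS0 : 0 ≤ S := by positivity
  have hSk : ∀ k, supBound α (rightAngle β γ k) M ≤ S := fun k => by
    unfold rightAngle
    have h1 := le_abs_self (supBound α β M)
    have h2 := le_abs_self (supBound α γ M)
    have h3 := abs_nonneg (supBound α β M)
    have h4 := abs_nonneg (supBound α γ M)
    split_ifs <;> linarith
  have hSJ : 0 ≤ S * J := by positivity
  refine ⟨S * (1 + J), by positivity, fun t ht k => ⟨?_, fun x hx => ?_, ?_⟩⟩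
  · refine (abs_eigenvalue_line_sub_le q h α (rightAngle β γ k) k.2 hMt ht).trans ?_
    have := mul_le_mul_of_nonneg_right (hSk k) hJ0
    linarith
  · refine (abs_sqEigenFun_le (q + t • h) α (rightAngle β γ k) k.2 (hMt t ht) hx).trans ?_
    linarith [hSk k]
  · refine (abs_integral_mul_sqEigenFun_le (q + t • h) α (rightAngle β γ k) k.2
      (intervalIntegrable_coe h) (hMt t ht)).trans ?_
    have := mul_le_mul_of_nonneg_right (hSk k) hJ0
    linarith

theorem exists_abs_lam_sub_le (α β γ : ℝ) (q Q : L2) :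
    ∃ C : ℝ, 0 ≤ C ∧ ∀ k, |lam α β γ q k - lam α β γ Q k| ≤ C := by
  obtain ⟨C, hC0, hC⟩ := exists_uniform_bound α β γ Q (q - Q)
  refine ⟨C, hC0, fun k => ?_⟩
  simpa using (hC 1 ⟨by norm_num, le_rfl⟩ k).1

variable {I : Set (Fin 2 × ℕ)} {w : Fin 2 × ℕ → ℝ}

/-- The weights themselves are summable: at most two of the indices have `n = 0`. -/
theorem summable_weights (hw : ∀ k ∈ I, 0 < w k)
    (hI : I.Finite ∨ Summable (fun k : I => (k.1.2 : ℝ) * w k.1)) :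
    Summable fun k : I => w k := by
  rcases hI with hI | hI
  · have := hI.to_subtype
    exact Summable.of_finite
  · have hfin : {k : I | k.1.2 = 0}.Finite := by
      refine Set.Finite.of_injOn (f := fun k : I => k.1.1) (t := univ) (fun _ _ => mem_univ _)
        (fun k hk l hl hkl => Subtype.ext (Prod.ext hkl ?_)) finite_univ
      exact (show k.1.2 = 0 from hk).trans (show l.1.2 = 0 from hl).symm
    have h0 : Summable fun k : I => if k.1.2 = 0 then w k else 0 :=
      summable_of_hasFiniteSupport (hfin.subset fun k hk => by
        by_contra h
        exact hk (if_neg h))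
    refine Summable.of_nonneg_of_le (fun k => (hw k k.2).le) (fun k => ?_) (hI.add h0)
    split_ifs with h
    · simp [h]
    · have h1 : (1 : ℝ) ≤ k.1.2 := by exact_mod_cast Nat.one_le_iff_ne_zero.2 h
      have := hw k k.2
      nlinarith

theorem summable_G (hw : ∀ k ∈ I, 0 < w k) (hws : Summable fun k : I => w k) (Q q : L2) :
    Summable fun k : I => w k * (lam α β γ q k - lam α β γ Q k) ^ 2 := by
  obtain ⟨C, hC0, hC⟩ := exists_abs_lam_sub_le α β γ q Q
  refine Summable.of_nonneg_of_le (fun k => mul_nonneg (hw k k.2).le (sq_nonneg _)) (fun k => ?_)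
    (hws.mul_right (C ^ 2))
  exact mul_le_mul_of_nonneg_left (sq_le_sq' (abs_le.1 (hC k)).1 (abs_le.1 (hC k)).2) (hw k k.2).le

theorem G_nonneg (hw : ∀ k ∈ I, 0 < w k) (Q q : L2) : 0 ≤ G α β γ I w Q q :=
  tsum_nonneg fun k => mul_nonneg (hw k k.2).le (sq_nonneg _)

/-- The functional has directional derivatives, which may be computed term by term. -/
theorem hasLineDerivAt_G (hw : ∀ k ∈ I, 0 < w k) (hws : Summable fun k : I => w k) (Q q h : L2) :
    HasLineDerivAt ℝ (G α β γ I w Q)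
      (∑' k : I, w k * (2 * (lam α β γ q k - lam α β γ Q k)) *
        ∫ x in (0 : ℝ)..1, h x * sqFun α β γ q k x) q h := by
  obtain ⟨C, hC0, hC⟩ := exists_uniform_bound α β γ q h
  obtain ⟨C', hC0', hC'⟩ := exists_abs_lam_sub_le α β γ q Q
  have hd : ∀ (k : I) (t : ℝ), HasDerivAt
      (fun t : ℝ => w k * (lam α β γ (q + t • h) k - lam α β γ Q k) ^ 2)
      (w k * (2 * (lam α β γ (q + t • h) k - lam α β γ Q k)) *
        ∫ x in (0 : ℝ)..1, h x * sqFun α β γ (q + t • h) k x) t := fun k t => by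
    refine ((((hasDerivAt_lam_line q h k t).sub_const (lam α β γ Q k)).pow 2).const_mul
      (w k)).congr_deriv ?_
    push_cast
    ring
  have h0 : (0 : ℝ) ∈ Ioo (-1 : ℝ) 1 := by constructor <;> norm_num
  have h1 := hasDerivAt_tsum_of_isPreconnected (u := fun k : I => w k * (2 * (C + C')) * C)
    ((hws.mul_right _).mul_right _) isOpen_Ioo isPreconnected_Ioo (fun k t _ => hd k t)
    (fun k t ht => by
      obtain ⟨b1, -, b3⟩ := hC t (Ioo_subset_Icc_self ht) k
      rw [Real.norm_eq_abs, abs_mul, abs_mul, abs_mul, abs_of_pos (hw k k.2), abs_two]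
      have b2 : |lam α β γ (q + t • h) k - lam α β γ Q k| ≤ C + C' :=
        (abs_sub_le _ (lam α β γ q k) _).trans (add_le_add b1 (hC' k))
      have := hw k k.2
      gcongr) h0 (by simpa using summable_G hw hws Q q) h0
  simpa [HasLineDerivAt, G] using h1

/-- Test functions represent elements of `H¹`. -/
theorem exists_memH1 {φ : ℝ → ℝ} (hφ : ContDiff ℝ ∞ φ) (hs : HasCompactSupport φ) :
    ∃ h : L2, MemH1 h ∧ h =ᵐ[volume.restrict (Icc (0 : ℝ) 1)] φ := by
  have hφ' : Continuous (deriv φ) := hφ.continuous_deriv (by simp)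
  have h1 : MemLp φ 2 (volume.restrict (Icc (0 : ℝ) 1)) :=
    hφ.continuous.memLp_of_hasCompactSupport hs
  have h2 : MemLp (deriv φ) 2 (volume.restrict (Icc (0 : ℝ) 1)) :=
    hφ'.memLp_of_hasCompactSupport hs.deriv
  refine ⟨h1.toLp φ, ⟨h2.toLp _, fun ψ hψ _ hsub => ?_⟩, h1.coeFn_toLp⟩
  have hψ' : Continuous (deriv ψ) := hψ.continuous_deriv (by simp)
  have hz : ∀ x, x ∉ Ioo (0 : ℝ) 1 → ψ x = 0 := fun x hx =>
    image_eq_zero_of_notMem_tsupport fun h => hx (hsub h)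
  have e1 : (fun x => h1.toLp φ x * deriv ψ x) =ᵐ[volume.restrict (Icc (0 : ℝ) 1)]
      fun x => φ x * deriv ψ x := by
    filter_upwards [h1.coeFn_toLp] with x hx; rw [hx]
  have e2 : (fun x => h2.toLp (deriv φ) x * ψ x) =ᵐ[volume.restrict (Icc (0 : ℝ) 1)]
      fun x => deriv φ x * ψ x := by
    filter_upwards [h2.coeFn_toLp] with x hx; rw [hx]
  rw [integral_congr_restrict e1, integral_congr_restrict e2,
    intervalIntegral.integral_mul_deriv_eq_deriv_mul
      (fun x _ => (hφ.differentiable (by simp) x).hasDerivAt)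
      (fun x _ => (hψ.differentiable (by simp) x).hasDerivAt)
      (hφ'.intervalIntegrable _ _) (hψ'.intervalIntegrable _ _),
    hz 0 (by simp), hz 1 (by simp)]
  simp

/-- A continuous function on `[0,1]` that is orthogonal to all test functions vanishes. -/
theorem eq_zero_of_integral_test {F : ℝ → ℝ} (hF : ContinuousOn F (Icc 0 1))
    (h : ∀ φ : ℝ → ℝ, ContDiff ℝ ∞ φ → HasCompactSupport φ → tsupport φ ⊆ Ioo 0 1 →
      ∫ x in (0 : ℝ)..1, φ x * F x = 0) {x : ℝ} (hx : x ∈ Icc (0 : ℝ) 1) : F x = 0 := by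
  have h1 : ∀ᵐ x : ℝ, x ∈ Ioo (0 : ℝ) 1 → F x = 0 := by
    refine isOpen_Ioo.ae_eq_zero_of_integral_contDiff_smul_eq_zero
      ((hF.mono Ioo_subset_Icc_self).locallyIntegrableOn measurableSet_Ioo) fun φ hφ hs hsub => ?_
    rw [← h φ hφ hs hsub, intervalIntegral.integral_of_le zero_le_one,
      setIntegral_eq_integral_of_forall_compl_eq_zero]
    · simp only [smul_eq_mul]
    · intro y hy
      rw [image_eq_zero_of_notMem_tsupport fun hy' => hy (Ioo_subset_Ioc_self (hsub hy')), zero_mul]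
  have h2 : F =ᵐ[volume.restrict (Icc (0 : ℝ) 1)] fun _ => 0 := by
    rw [← Measure.restrict_congr_set Ioo_ae_eq_Icc]
    exact (ae_restrict_iff' measurableSet_Ioo).2 h1
  exact Measure.eqOn_Icc_of_ae_eq volume zero_ne_one h2 hF continuousOn_const hx

/-- At a critical point of the functional all prescribed eigenvalues have the prescribed values:
otherwise the squared eigenfunctions would be linearly dependent. -/
theorem lam_eq_of_lineDeriv_eq_zero (hβγ : Real.sin (β - γ) ≠ 0) (hw : ∀ k ∈ I, 0 < w k)
    (hws : Summable fun k : I => w k) {Q q : L2}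
    (hcrit : ∀ h : L2, MemH1 h → lineDeriv ℝ (G α β γ I w Q) q h = 0) (k : I) :
    lam α β γ q k = lam α β γ Q k := by
  -- The direction `0` serves to bound the squared eigenfunctions at `q` itself.
  obtain ⟨C, hC0, hC⟩ := exists_uniform_bound α β γ q 0
  obtain ⟨C', hC0', hC'⟩ := exists_abs_lam_sub_le α β γ q Q
  have hsq : ∀ k : I, ∀ x ∈ Icc (0 : ℝ) 1, |sqFun α β γ q k x| ≤ C := fun k x hx => by
    simpa using (hC 0 ⟨by norm_num, by norm_num⟩ k).2.1 x hx
  set c : I → ℝ := fun k => w k * (2 * (lam α β γ q k - lam α β γ Q k)) with hcdef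
  have hc : Summable fun k => |c k| := by
    refine Summable.of_nonneg_of_le (fun _ => abs_nonneg _) (fun k => ?_) (hws.mul_right (2 * C'))
    rw [hcdef, abs_mul, abs_mul, abs_of_pos (hw k k.2), abs_two]
    have := hw k k.2
    have := hC' k
    gcongr
  have hcont : ∀ k : I, ContinuousOn (sqFun α β γ q k) (Icc 0 1) := fun k =>
    continuousOn_sqEigenFun q α _ _
  have hbd : ∀ (k : I), ∀ x ∈ Icc (0 : ℝ) 1, ‖c k * sqFun α β γ q k x‖ ≤ |c k| * C :=
    fun k x hx => by
      rw [Real.norm_eq_abs, abs_mul]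
      exact mul_le_mul_of_nonneg_left (hsq k x hx) (abs_nonneg _)
  have hF : ContinuousOn (fun x => ∑' k, c k * sqFun α β γ q k x) (Icc 0 1) :=
    continuousOn_tsum (fun k => continuousOn_const.mul (hcont k)) (hc.mul_right C) hbd
  have h0 : ∀ x ∈ Icc (0 : ℝ) 1, ∑' k, c k * sqFun α β γ q k x = 0 := fun x hx => by
    refine eq_zero_of_integral_test hF (fun φ hφ hs _ => ?_) hx
    obtain ⟨h, hH1, hφh⟩ := exists_memH1 hφ hs
    have e := (hasLineDerivAt_G (α := α) (β := β) (γ := γ) hw hws Q q h).lineDeriv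
    rw [hcrit h hH1] at e
    refine (hasSum_mul_integral hc hcont hsq
      (hφ.continuous.intervalIntegrable 0 1)).tsum_eq.symm.trans
      ((tsum_congr fun k => ?_).trans e.symm)
    congr 1
    refine integral_congr_restrict ?_
    filter_upwards [hφh] with x hx
    rw [hx]
  have hck := eq_zero_of_tsum_sqEigenFun_eq_zero (α := α) hβγ q hc hsq h0 k
  have hwk := (hw k k.2).ne'
  simpa [hcdef, hwk, sub_eq_zero] using hck

end

end SturmLiouville


theorem theorem2 (α β γ : ℝ) (hβγ : Real.sin (β - γ) ≠ 0)
    (I : Set (Fin 2 × ℕ)) (w : Fin 2 × ℕ → ℝ) (hw : ∀ k ∈ I, 0 < w k)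
    (hI : I.Finite ∨ Summable (fun k : I => (k.1.2 : ℝ) * w k.1))
    (Q q : SturmLiouville.L2) :
    -- the series defining `G(q)` converges
    Summable (fun k : I => w k *
      (SturmLiouville.lam α β γ q k - SturmLiouville.lam α β γ Q k) ^ 2) ∧
    -- the directional derivatives of `G` at `q` exist
    (∀ h : SturmLiouville.L2, SturmLiouville.MemH1 h →
      LineDifferentiableAt ℝ (SturmLiouville.G α β γ I w Q) q h) ∧
    -- they all vanish if and only if `G(q) = 0`
    ((∀ h : SturmLiouville.L2, SturmLiouville.MemH1 h →
      lineDeriv ℝ (SturmLiouville.G α β γ I w Q) q h = 0) ↔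
        SturmLiouville.G α β γ I w Q q = 0) ∧
    -- a critical point is a global minimum
    ((∀ h : SturmLiouville.L2, SturmLiouville.MemH1 h →
      lineDeriv ℝ (SturmLiouville.G α β γ I w Q) q h = 0) →
        ∀ p : SturmLiouville.L2,
          SturmLiouville.G α β γ I w Q q ≤ SturmLiouville.G α β γ I w Q p) ∧
    -- there is no local minimum (in `L²`) with positive value
    (0 < SturmLiouville.G α β γ I w Q q →
      ¬ IsLocalMin (SturmLiouville.G α β γ I w Q) q) := by
  have hws := SturmLiouville.summable_weights hw hI
  have hnn := fun p => SturmLiouville.G_nonneg (α := α) (β := β) (γ := γ) hw Q p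
  have hcrit : (∀ h : SturmLiouville.L2, SturmLiouville.MemH1 h →
      lineDeriv ℝ (SturmLiouville.G α β γ I w Q) q h = 0) →
        SturmLiouville.G α β γ I w Q q = 0 := fun hc => by
    have hlam := SturmLiouville.lam_eq_of_lineDeriv_eq_zero hβγ hw hws hc
    simp [SturmLiouville.G, hlam]
  refine ⟨SturmLiouville.summable_G hw hws Q q, fun h _ =>
    (SturmLiouville.hasLineDerivAt_G hw hws Q q h).lineDifferentiableAt, ⟨hcrit, fun h0 h _ => ?_⟩,
    fun hc p => (hcrit hc).trans_le (hnn p), fun hpos hmin => ?_⟩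
  · have hmin : IsLocalMin (SturmLiouville.G α β γ I w Q) q :=
      Filter.Eventually.of_forall fun p => h0.trans_le (hnn p)
    rw [hmin.lineDeriv_eq_zero, Pi.zero_apply]
  · refine hpos.ne' (hcrit fun h _ => ?_)
    rw [hmin.lineDeriv_eq_zero, Pi.zero_apply]
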